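/- Let $m\ge 2$ and let $p:\mathbb R\to[0,\infty)$ be continuous and $2\pi$-periodic with $\int_0^{2\pi}p(x)\,dx=1$ and $\int_0^{2\pi}\prod_{l=0}^{m-1}p\left(x+\frac{2\pi l}{m}\right)dx>0$. Let $U_1,U_2,\dots$ be independent random points on the unit circle $S^1$ with common density $p$ (as a function of the polar angle, with respect to arc length). Let $g:[0,2\pi]\to\mathbb R$ be continuous, three times continuously differentiable in a neighbourhood of each point $\frac{2\pi s}{m}$, $s\in\{1,\dots,m-1\}$, and such that $g(x)=g(2\pi-x)$ for all $x\in[0,2\pi]$. For points $u_1,\dots,u_m\in S^1$ put $\beta_0=0$, let $\beta_i\in[0,2\pi)$ be the counterclockwise angle from $u_1$ to $u_{i+1}$ seen from the centre ($1\le i\le m-1$), and let $$f(u_1,\dots,u_m)=\sum_{0\le i<j\le m-1}g(|\beta_j-\beta_i|).$$ Suppose that $f$ attains its maximum over $(S^1)^m$ only at $m$-tuples consisting, in some order, of the vertices of a regular $m$-gon inscribed in $S^1$. Let $G=(g_{i,j})_{i,j=1}^{m-1}$ be the symmetric matrix with $$g_{i,j}=-g''\left(\tfrac{2\pi|i-j|}{m}\right)\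 (i\ne j),\qquad g_{i,i}=\sum_{s=1}^{m-1}g''\left(\tfrac{2\pi s}{m}\right),$$ and suppose that $\det G\ne0$. For $n\ge m$ let $$H_n=\max_{1\le i_1<\dots<i_m\le n}f(U_{i_1},\dots,U_{i_m}).$$ Then for every $t>0$ $$\lim_{n\to\infty}\mathbb P\left\{n^{\frac{2m}{m-1}}\left(\frac12\sum_{s=1}^{m-1}m\,g\left(\tfrac{2\pi s}{m}\right)-H_n\right)\le t\right\}=1-\exp\left(-\frac{t^{\frac{m-1}{2}}K}{m}\right),$$ where $$K=\frac{(2\pi)^{\frac{m-1}{2}}\int_0^{2\pi}\prod_{l=0}^{m-1}p\left(x+\frac{2\pi l}{m}\right)dx}{\sqrt{\det(-G)}\;\Gamma\left(\frac{m+1}{2}\right)}.$$ -/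

import Mathlib

open MeasureTheory ProbabilityTheory Filter Topology

noncomputable section

namespace UMax

instance instMeasurableSpaceCircle : MeasurableSpace Circle := borel Circle

instance instBorelSpaceCircle : BorelSpace Circle := ⟨rfl⟩

/-- The counterclockwise angle, in `[0, 2π)`, from the point `u` of the unit circle to the
point `v`, seen from the centre. -/
def ccwAngle (u v : Circle) : ℝ :=
  toIcoMod Real.two_pi_pos 0 (Complex.arg ((v / u : Circle) : ℂ))

/-- The central angles `β_0 = 0, β_1, …, β_{m-1}` of `m` points on the circle: the
counterclockwise angles from the first point to the others. -/
def centralAngle {m : ℕ} [NeZero m] (U : Fin m → Circle) (i : Fin m) : ℝ :=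
  ccwAngle (U 0) (U i)

/-- The kernel `f(U_1, …, U_m) = ∑_{0 ≤ i < j ≤ m - 1} g(|β_j - β_i|)`. -/
def kernel (g : ℝ → ℝ) {m : ℕ} [NeZero m] (U : Fin m → Circle) : ℝ :=
  ∑ i : Fin m, ∑ j ∈ Finset.Ioi i, g |centralAngle U j - centralAngle U i|

/-- The points `U_1, …, U_m` are, in some order, the vertices of a regular `m`-gon inscribed in
the unit circle. -/
def IsRegularPolygon {m : ℕ} (U : Fin m → Circle) : Prop :=
  ∃ (z : Circle) (σ : Equiv.Perm (Fin m)),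
    ∀ i : Fin m, U (σ i) = z * Circle.exp (2 * Real.pi * (i : ℕ) / m)

/-- The `U`-max statistic: the maximum of `f(U_{i_1}, …, U_{i_m})` over all choices of indices
`i_1 < … < i_m` among the first `n`. The supremum is over a finite set, which is nonempty as soon
as `n ≥ m`. -/
def uMax {m : ℕ} (f : (Fin m → Circle) → ℝ) (U : ℕ → Circle) (n : ℕ) : ℝ :=
  ⨆ e : Fin m ↪o Fin n, f (fun k => U (e k))

/-- The measure on the unit circle that has density `p` with respect to arc length, `p` being
written as a function of the polar angle. -/
def circleLaw (p : ℝ → ℝ) : Measure Circle :=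
  ((volume.restrict (Set.Ico 0 (2 * Real.pi))).withDensity
    (fun x => ENNReal.ofReal (p x))).map Circle.exp

/-- The symmetric Toeplitz matrix with diagonal entries `∑_{s=1}^{m-1} g''(2πs/m)` and
off-diagonal entries `-g''(2π|i-j|/m)`. -/
def matG (g : ℝ → ℝ) (m : ℕ) : Matrix (Fin (m - 1)) (Fin (m - 1)) ℝ :=
  Matrix.of fun i j =>
    if i = j then ∑ s ∈ Finset.Icc 1 (m - 1), iteratedDeriv 2 g (2 * Real.pi * s / m)
    else -iteratedDeriv 2 g (2 * Real.pi * |((i : ℕ) : ℝ) - ((j : ℕ) : ℝ)| / m)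

/-- The integral `∫_0^{2π} ∏_{l=0}^{m-1} p(x + 2πl/m) dx`. -/
def densityIntegral (p : ℝ → ℝ) (m : ℕ) : ℝ :=
  ∫ x in (0 : ℝ)..(2 * Real.pi), ∏ l ∈ Finset.range m, p (x + 2 * Real.pi * l / m)

/-- The constant `K` of the limit law. -/
def constK (g p : ℝ → ℝ) (m : ℕ) : ℝ :=
  (2 * Real.pi) ^ (((m : ℝ) - 1) / 2) * densityIntegral p m /
    (Real.sqrt (-matG g m).det * Real.Gamma (((m : ℝ) + 1) / 2))

end UMax

end

/-! Write m = k + 1, let M be the value of f at a regular polygon, and put r = √t n^{-m/(m-1)}. The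
event in question says that some m of the first n points satisfy f ≥ M - r². The number of such
tuples is a sum of rare indicators, and indicators of tuples without a common index are independent.
So the number is nearly Poisson, and the limit is 1 - exp(-λ) with λ the limit of its mean.

The mean. In polar angles f becomes `pairSum` of the even periodic extension of g, which is
invariant under rotations and permutations. By compactness a nearly maximal tuple is close to a
regular polygon. There, with the first angle set to 0, M - f is ½ y·(-G)y up to o(‖y‖²). The linear
term vanishes and -G is positive definite because the point is a maximum and det G ≠ 0
(`posDef_of_isMax`). Integrating the law of the angles over rotations (`pi_angleLaw_superlevel`)
leaves a density for the differences, equal to ∫∏p at the polygon. The superlevel set consists of k!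
congruent pieces, each asymptotic to an ellipsoid scaled by r (`tendsto_integral_ball_sublevel`,
`tendsto_setIntegral_cube`). A tuple therefore qualifies with probability ~ k! K r^k. Since n.choose
m ~ n^m / m! and n^m r^k = t^{k/2}, the mean tends to t^{k/2} K / m.

The Poisson approximation. For s in [0,1] the generating function φ(s) = E s^W of the count W
satisfies φ' ≈ λφ. Integration from 0 to 1 compares P(W = 0) with e^{-λ}
(`abs_measureReal_forall_notMem_sub_exp_le`). The error comes from pairs of overlapping tuples. In a
qualifying tuple one point confines each other point to finitely many arcs of length O(r)
(`exists_int_abs_sub_le`), so each additional index costs a factor a = O(r). As n r → 0, the error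
vanishes (`abs_measureReal_forall_tuple_notMem_sub_exp_le`). The two halves meet in
`tendsto_prob_no_tuple`. -/

noncomputable section

namespace UMax

/-! ### Poisson approximation for dissociated events -/

section Poisson

/-- Here s ^ a ≤ 1, and 1 - s ^ b is 0 for b = 0 and at most 1 ≤ b otherwise. The bound turns a
change of exponent into a count of events. -/
lemma abs_pow_sub_pow_le_of_mem_Icc {s : ℝ} (h0 : 0 ≤ s) (h1 : s ≤ 1) (a b : ℕ) :
    |s ^ (a + b) - s ^ a| ≤ b := by
  have hb : 1 - s ^ b ≤ b := by
    rcases Nat.eq_zero_or_pos b with rfl | hb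
    · simp
    · have : (1 : ℝ) ≤ b := by exact_mod_cast hb
      linarith [pow_nonneg h0 b]
  have h2 : s ^ b ≤ 1 := pow_le_one₀ h0 h1
  have h3 : s ^ a ≤ 1 := pow_le_one₀ h0 h1
  have h4 : 0 ≤ s ^ a := pow_nonneg h0 a
  rw [abs_sub_comm, pow_add, abs_of_nonneg (by nlinarith)]
  nlinarith

variable {Ω ι : Type*}

/-- The number of the events `I β`, `β ∈ B`, that occur. -/
def countEvents (I : ι → Set Ω) (B : Finset ι) (ω : Ω) : ℕ :=
  ∑ β ∈ B, (I β).indicator (fun _ => 1) ω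

lemma countEvents_le (I : ι → Set Ω) (B : Finset ι) (ω : Ω) : countEvents I B ω ≤ B.card := by
  rw [Finset.card_eq_sum_ones]
  refine Finset.sum_le_sum fun β _ => ?_
  exact Set.indicator_le_self' (by simp) ω

lemma cast_countEvents (I : ι → Set Ω) (B : Finset ι) (ω : Ω) :
    (countEvents I B ω : ℝ) = ∑ β ∈ B, (I β).indicator (fun _ => (1 : ℝ)) ω := by
  unfold countEvents
  push_cast
  refine Finset.sum_congr rfl fun β _ => ?_
  by_cases h : ω ∈ I β <;> simp [h]

variable [MeasurableSpace Ω]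

lemma measurable_countEvents {I : ι → Set Ω} (hI : ∀ α, MeasurableSet (I α)) (B : Finset ι) :
    Measurable (countEvents I B) := by
  unfold countEvents
  exact Finset.measurable_sum _ fun β _ => measurable_const.indicator (hI β)

variable (μ : Measure Ω) [IsProbabilityMeasure μ]

/-- The shift c is 0 or 1 in use. With c = 1 the subtraction truncates only where no event occurs,
and there the term is multiplied by zero or excluded by the domain of integration. -/
lemma integrable_pow_countEvents {I : ι → Set Ω} (hI : ∀ α, MeasurableSet (I α)) (B : Finset ι)
    {s : ℝ} (h0 : 0 ≤ s) (h1 : s ≤ 1) (c : ℕ) :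
    Integrable (fun ω => s ^ (countEvents I B ω - c)) μ := by
  refine Integrable.of_bound (C := 1) ?_ (ae_of_all _ fun ω => ?_)
  · have : Measurable fun n : ℕ => s ^ (n - c) := measurable_of_countable _
    exact (this.comp (measurable_countEvents hI B)).aestronglyMeasurable
  · rw [Real.norm_of_nonneg (pow_nonneg h0 _)]
    exact pow_le_one₀ h0 h1

lemma integrable_countEvents {I : ι → Set Ω} (hI : ∀ α, MeasurableSet (I α)) (B : Finset ι) :
    Integrable (fun ω => (countEvents I B ω : ℝ)) μ := by
  refine Integrable.of_bound (C := B.card) ?_ (ae_of_all _ fun ω => ?_)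
  · have : Measurable fun n : ℕ => (n : ℝ) := measurable_of_countable _
    exact (this.comp (measurable_countEvents hI B)).aestronglyMeasurable
  · rw [Real.norm_of_nonneg (Nat.cast_nonneg _)]
    exact_mod_cast countEvents_le I B ω

lemma setIntegral_countEvents {I : ι → Set Ω} (hI : ∀ α, MeasurableSet (I α)) (B : Finset ι)
    (A : Set Ω) :
    ∫ ω in A, (countEvents I B ω : ℝ) ∂μ = ∑ β ∈ B, μ.real (A ∩ I β) := by
  simp_rw [cast_countEvents]
  rw [integral_finsetSum]
  · refine Finset.sum_congr rfl fun β _ => ?_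
    rw [integral_indicator_const _ (hI β), measureReal_restrict_apply (hI β), Set.inter_comm]
    simp
  · intro β _
    exact ((integrable_const 1).indicator (hI β))

lemma hasDerivAt_integral_pow_countEvents {I : ι → Set Ω} (hI : ∀ α, MeasurableSet (I α))
    (B : Finset ι) {s : ℝ} (h0 : 0 ≤ s) (h1 : s ≤ 1) :
    HasDerivAt (fun s : ℝ => ∫ ω, s ^ countEvents I B ω ∂μ)
      (∫ ω, (countEvents I B ω : ℝ) * s ^ (countEvents I B ω - 1) ∂μ) s := by
  have hm (f : ℕ → ℝ) : AEStronglyMeasurable (fun ω => f (countEvents I B ω)) μ :=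
    ((measurable_of_countable f).comp (measurable_countEvents hI B)).aestronglyMeasurable
  -- The ball of radius 2 is a neighbourhood of every s in [0,1], endpoints included. On it |s| ≤ 2
  -- and the count is at most `B.card`, which gives the dominating constant.
  refine (hasDerivAt_integral_of_dominated_loc_of_deriv_le (s := Metric.ball 0 2)
    (bound := fun _ => (B.card : ℝ) * 2 ^ B.card)
    (F' := fun s ω => (countEvents I B ω : ℝ) * s ^ (countEvents I B ω - 1))
    ?_ ?_ ?_ ?_ ?_ ?_ ?_).2
  · exact Metric.isOpen_ball.mem_nhds (by simp [abs_of_nonneg h0]; linarith)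
  · exact Eventually.of_forall fun x => hm (fun n => x ^ n)
  · simpa using integrable_pow_countEvents μ hI B h0 h1 0
  · exact hm (fun n => (n : ℝ) * s ^ (n - 1))
  · refine ae_of_all _ fun ω x hx => ?_
    have hx' : |x| ≤ 2 := by simpa using (mem_ball_zero_iff.1 hx).le
    have hc := countEvents_le I B ω
    rw [norm_mul, norm_pow, Real.norm_eq_abs, Real.norm_eq_abs, Nat.abs_cast]
    have h3 : |x| ^ (countEvents I B ω - 1) ≤ 2 ^ B.card :=
      (pow_le_pow_left₀ (abs_nonneg x) hx' _).trans
        (pow_le_pow_right₀ (by norm_num) (by omega))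
    have h4 : (countEvents I B ω : ℝ) ≤ B.card := by exact_mod_cast hc
    gcongr
  · exact integrable_const _
  · exact ae_of_all _ fun ω x _ => hasDerivAt_pow _ x

variable [Fintype ι] [DecidableEq ι]

/-- One summand of the derivative of the generating function of a sum of dissociated
indicators. -/
lemma abs_setIntegral_pow_countEvents_sub_le {I : ι → Set Ω} (hI : ∀ α, MeasurableSet (I α))
    {N : ι → Finset ι} (hN : ∀ α, α ∈ N α) (α : ι)
    {s : ℝ} (h0 : 0 ≤ s) (h1 : s ≤ 1)
    (hind : ∫ ω in I α, s ^ countEvents I (N α)ᶜ ω ∂μ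
      = μ.real (I α) * ∫ ω, s ^ countEvents I (N α)ᶜ ω ∂μ) :
    |∫ ω in I α, s ^ (countEvents I Finset.univ ω - 1) ∂μ
        - μ.real (I α) * ∫ ω, s ^ countEvents I Finset.univ ω ∂μ| ≤
      ∑ β ∈ N α, μ.real (I α) * μ.real (I β) + ∑ β ∈ (N α).erase α, μ.real (I α ∩ I β) := by
  have hW (ω : Ω) : countEvents I Finset.univ ω
      = countEvents I (N α)ᶜ ω + countEvents I (N α) ω :=
    (Finset.sum_compl_add_sum (N α) _).symm
  have hZ (ω : Ω) (hω : ω ∈ I α) : countEvents I (N α) ω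
      = countEvents I ((N α).erase α) ω + 1 := by
    have := Finset.sum_erase_add (N α) (fun β => (I β).indicator (fun _ => 1) ω) (hN α)
    simp only [hω, Set.indicator_of_mem] at this
    exact this.symm
  have hV : Integrable (fun ω => s ^ countEvents I (N α)ᶜ ω) μ := by
    simpa using integrable_pow_countEvents μ hI (N α)ᶜ h0 h1 0
  -- On `I α` the total count less one exceeds the count outside `N α` by the number of other events
  -- of `N α`.
  have e1 : |∫ ω in I α, s ^ (countEvents I Finset.univ ω - 1) ∂μ
      - ∫ ω in I α, s ^ countEvents I (N α)ᶜ ω ∂μ|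
      ≤ ∑ β ∈ (N α).erase α, μ.real (I α ∩ I β) := by
    rw [← setIntegral_countEvents μ hI, ← integral_sub
      (integrable_pow_countEvents μ hI _ h0 h1 1).integrableOn
      hV.integrableOn,
      ← Real.norm_eq_abs]
    refine (norm_integral_le_integral_norm _).trans ?_
    refine setIntegral_mono_on ?_ (integrable_countEvents μ hI _).integrableOn (hI α) ?_
    · refine (Integrable.norm ?_)
      exact (integrable_pow_countEvents μ hI _ h0 h1 1).integrableOn.sub
        hV.integrableOn
    · intro ω hω
      rw [hW, hZ ω hω, Real.norm_eq_abs, ← add_assoc, Nat.add_sub_cancel]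
      exact abs_pow_sub_pow_le_of_mem_Icc h0 h1 _ _
  -- After independence has factored out P(I α), the events of `N α` are put back into the count.
  have e2 : |∫ ω, s ^ countEvents I (N α)ᶜ ω ∂μ - ∫ ω, s ^ countEvents I Finset.univ ω ∂μ|
      ≤ ∑ β ∈ N α, μ.real (I β) := by
    have := setIntegral_countEvents μ hI (N α) Set.univ
    simp only [Set.univ_inter, Measure.restrict_univ] at this
    rw [← this, ← integral_sub
      (by simpa using (integrable_pow_countEvents μ hI _ h0 h1 0))
      (by simpa using (integrable_pow_countEvents μ hI _ h0 h1 0)),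
      ← Real.norm_eq_abs]
    refine (norm_integral_le_integral_norm _).trans ?_
    refine integral_mono ?_ (integrable_countEvents μ hI _) ?_
    · refine (Integrable.norm ?_)
      exact Integrable.sub (by simpa using (integrable_pow_countEvents μ hI _ h0 h1 0))
        (by simpa using (integrable_pow_countEvents μ hI _ h0 h1 0))
    · intro ω
      simp only [hW, Real.norm_eq_abs]
      rw [abs_sub_comm]
      exact abs_pow_sub_pow_le_of_mem_Icc h0 h1 _ _
  rw [hind] at e1
  rw [← Finset.mul_sum]
  have hp : 0 ≤ μ.real (I α) := measureReal_nonneg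
  have e3 := mul_le_mul_of_nonneg_left e2 hp
  rw [← abs_of_nonneg hp, ← abs_mul, abs_of_nonneg hp, mul_sub] at e3
  have := abs_add_le (∫ ω in I α, s ^ (countEvents I Finset.univ ω - 1) ∂μ
    - μ.real (I α) * ∫ ω, s ^ countEvents I (N α)ᶜ ω ∂μ)
    (μ.real (I α) * ∫ ω, s ^ countEvents I (N α)ᶜ ω ∂μ
      - μ.real (I α) * ∫ ω, s ^ countEvents I Finset.univ ω ∂μ)
  rw [sub_add_sub_cancel] at this
  linarith

/-- Poisson approximation for the probability that none of a family of dissociated events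
occurs. -/
theorem abs_measureReal_forall_notMem_sub_exp_le {I : ι → Set Ω}
    (hI : ∀ α, MeasurableSet (I α)) {N : ι → Finset ι} (hN : ∀ α, α ∈ N α)
    (hind : ∀ α (s : ℝ), ∫ ω in I α, s ^ countEvents I (N α)ᶜ ω ∂μ
      = μ.real (I α) * ∫ ω, s ^ countEvents I (N α)ᶜ ω ∂μ) :
    |μ.real {ω | ∀ α, ω ∉ I α} - Real.exp (-∑ α, μ.real (I α))| ≤
      ∑ α, (∑ β ∈ N α, μ.real (I α) * μ.real (I β)
        + ∑ β ∈ (N α).erase α, μ.real (I α ∩ I β)) := by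
  set l := ∑ α, μ.real (I α) with hl
  set W := countEvents I Finset.univ with hWdef
  set D := ∑ α, (∑ β ∈ N α, μ.real (I α) * μ.real (I β)
        + ∑ β ∈ (N α).erase α, μ.real (I α ∩ I β)) with hD
  have hl0 : 0 ≤ l := Finset.sum_nonneg fun α _ => measureReal_nonneg
  set φ : ℝ → ℝ := fun s => ∫ ω, s ^ W ω ∂μ with hφ
  set φ' : ℝ → ℝ := fun s => ∫ ω, (W ω : ℝ) * s ^ (W ω - 1) ∂μ with hφ'
  have hderiv : ∀ s ∈ Set.Icc (0 : ℝ) 1, HasDerivAt φ (φ' s) s := fun s hs =>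
    hasDerivAt_integral_pow_countEvents μ hI _ hs.1 hs.2
  have hbound : ∀ s ∈ Set.Icc (0 : ℝ) 1, |φ' s - l * φ s| ≤ D := by
    intro s hs
    have : φ' s = ∑ α, ∫ ω in I α, s ^ (W ω - 1) ∂μ := by
      simp only [hφ']
      have : ∀ ω, (W ω : ℝ) * s ^ (W ω - 1)
          = ∑ α, (I α).indicator (fun ω => s ^ (W ω - 1)) ω := by
        intro ω
        rw [hWdef, cast_countEvents, Finset.sum_mul]
        refine Finset.sum_congr rfl fun α _ => ?_
        by_cases h : ω ∈ I α <;> simp [h]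
      simp_rw [this]
      rw [integral_finsetSum]
      · exact Finset.sum_congr rfl fun α _ => integral_indicator (hI α)
      · intro α _
        exact (integrable_pow_countEvents μ hI _ hs.1 hs.2 1).indicator (hI α)
    rw [this, hl, Finset.sum_mul, ← Finset.sum_sub_distrib]
    refine (Finset.abs_sum_le_sum_abs _ _).trans (Finset.sum_le_sum fun α _ => ?_)
    exact abs_setIntegral_pow_countEvents_sub_le μ hI hN α hs.1 hs.2 (hind α s)
  -- Integrating factor: e^{-ls} φ(s) has derivative at most D in absolute value, and its values at
  -- 0 and 1 are P(W = 0) and e^{-l}.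
  have key := norm_image_sub_le_of_norm_deriv_le_segment_01' (C := D)
    (f := fun s => Real.exp (-l * s) * φ s)
    (f' := fun s => Real.exp (-l * s) * (φ' s - l * φ s)) ?_ ?_
  · have p0 : φ 0 = μ.real {ω | ∀ α, ω ∉ I α} := by
      have hms : MeasurableSet {ω | ∀ α, ω ∉ I α} := by
        have : {ω | ∀ α, ω ∉ I α} = ⋂ α, (I α)ᶜ := by ext; simp
        rw [this]
        exact MeasurableSet.iInter fun α => (hI α).compl
      -- The convention 0 ^ 0 = 1 makes φ(0) the probability that no event occurs.
      have : ∀ ω, (0 : ℝ) ^ W ω = {ω | ∀ α, ω ∉ I α}.indicator (fun _ => (1 : ℝ)) ω := by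
        intro ω
        by_cases h : ∀ α, ω ∉ I α
        · have : W ω = 0 := by
            simp only [hWdef, countEvents]
            exact Finset.sum_eq_zero fun α _ => by simp [h α]
          rw [Set.indicator_of_mem (by exact h), this, pow_zero]
        · rw [Set.indicator_of_notMem (by exact h)]
          push Not at h
          obtain ⟨α, hα⟩ := h
          refine zero_pow ?_
          simp only [hWdef, countEvents]
          intro h0
          have := (Finset.sum_eq_zero_iff.1 h0) α (Finset.mem_univ α)
          simp [hα] at this
      simp only [hφ, this]
      rw [integral_indicator_const _ hms]
      simp
    have p1 : φ 1 = 1 := by simp [hφ]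
    simp only [mul_one, mul_zero, Real.exp_zero, one_mul, p0, p1] at key
    rwa [abs_sub_comm]
  · intro s hs
    have h1 : HasDerivAt (fun s => Real.exp (-l * s)) (Real.exp (-l * s) * (-l)) s := by
      simpa using ((hasDerivAt_id s).const_mul (-l)).exp
    have := (h1.mul (hderiv s hs)).hasDerivWithinAt (s := Set.Icc 0 1)
    exact this.congr_deriv (by ring)
  · intro s hs
    have hs' : s ∈ Set.Icc (0 : ℝ) 1 := Set.Ico_subset_Icc_self hs
    rw [norm_mul, Real.norm_eq_abs, Real.norm_eq_abs, Real.abs_exp]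
    have : Real.exp (-l * s) ≤ 1 := Real.exp_le_one_iff.2 (by nlinarith [hs.1])
    calc _ ≤ 1 * |φ' s - l * φ s| := by gcongr
      _ ≤ D := by rw [one_mul]; exact hbound s hs'

end Poisson

/-! ### Tuples drawn from an i.i.d. sequence -/

section IID

variable {Ω S : Type*} [MeasurableSpace S] {n m : ℕ}

/-- The set of values of an increasing tuple of indices. -/
def indexSet (α : Fin m ↪o Fin n) : Finset (Fin n) := Finset.univ.map α.toEmbedding

lemma mem_indexSet (α : Fin m ↪o Fin n) (i : Fin m) : α i ∈ indexSet α := by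
  simp [indexSet]

lemma exists_of_mem_indexSet {α : Fin m ↪o Fin n} {k : Fin n} (h : k ∈ indexSet α) :
    ∃ i, α i = k := by
  simpa [indexSet] using h

lemma card_indexSet (α : Fin m ↪o Fin n) : (indexSet α).card = m := by
  simp [indexSet]

lemma indexSet_injective : Function.Injective (indexSet : (Fin m ↪o Fin n) → Finset (Fin n)) := by
  intro α β h
  have h2 : Set.range α = Set.range β := by
    ext k
    have := Finset.ext_iff.1 h k
    simpa [indexSet] using this
  exact OrderEmbedding.range_inj.1 h2

lemma card_orderEmbedding (m n : ℕ) : Fintype.card (Fin m ↪o Fin n) = n.choose m := by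
  have : (Finset.univ : Finset (Fin m ↪o Fin n)).card
      = (Finset.powersetCard m (Finset.univ : Finset (Fin n))).card := by
    refine Finset.card_bij (fun α _ => indexSet α) ?_ ?_ ?_
    · intro α _
      simp [Finset.mem_powersetCard, card_indexSet]
    · intro α _ β _ h
      exact indexSet_injective h
    · intro s hs
      have hs' : s.card = m := (Finset.mem_powersetCard.1 hs).2
      refine ⟨s.orderEmbOfFin hs', Finset.mem_univ _, ?_⟩
      apply Finset.coe_injective
      simp [indexSet]
  rw [← Finset.card_univ, this, Finset.card_powersetCard, Finset.card_univ, Fintype.card_fin]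

/-- The increasing tuples of indices that share an index with a given one. -/
def overlapping (α : Fin m ↪o Fin n) : Finset (Fin m ↪o Fin n) :=
  Finset.univ.filter fun β => ¬ Disjoint (indexSet α) (indexSet β)

/-- β is determined by the part of its index set inside that of α, for which there are 2 ^ m
choices, and the part outside. -/
lemma sum_overlapping_le (α : Fin m ↪o Fin n) (w : Finset (Fin n) → ℝ) (hw : ∀ E, 0 ≤ w E)
    (B : Finset (Fin m ↪o Fin n)) (𝓔 : Finset (Finset (Fin n)))
    (hB : ∀ β ∈ B, indexSet β \ indexSet α ∈ 𝓔) :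
    ∑ β ∈ B, w (indexSet β \ indexSet α) ≤ 2 ^ m * ∑ E ∈ 𝓔, w E := by
  classical
  have h1 : ∑ β ∈ B, w (indexSet β \ indexSet α)
      = ∑ x ∈ B.image (fun β => (indexSet β ∩ indexSet α, indexSet β \ indexSet α)), w x.2 := by
    rw [Finset.sum_image]
    intro β _ γ _ h
    apply indexSet_injective
    have h1 := congrArg Prod.fst h
    have h2 := congrArg Prod.snd h
    simp only at h1 h2
    rw [← Finset.sdiff_union_inter (indexSet β) (indexSet α), h1, h2, Finset.sdiff_union_inter]
  rw [h1]
  calc _ ≤ ∑ x ∈ (indexSet α).powerset ×ˢ 𝓔, w x.2 := by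
        refine Finset.sum_le_sum_of_subset_of_nonneg ?_ fun x _ _ => hw _
        intro x hx
        obtain ⟨β, hβ, rfl⟩ := Finset.mem_image.1 hx
        simp [hB β hβ]
    _ = _ := by
        rw [Finset.sum_product]
        simp [Finset.card_powerset, card_indexSet]

/-- The binomial theorem treats overlaps of every size at once; the sum tends to 0 as soon as n a
does. -/
lemma sum_pow_card_nonempty (a : ℝ) :
    ∑ E ∈ (Finset.univ : Finset (Finset (Fin n))).erase ∅, a ^ E.card = (1 + a) ^ n - 1 := by
  have h := Finset.sum_erase_add (Finset.univ : Finset (Finset (Fin n)))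
    (fun E => a ^ E.card) (Finset.mem_univ ∅)
  have h2 := Finset.sum_pow_mul_eq_add_pow a 1 (Finset.univ : Finset (Fin n))
  simp only [one_pow, mul_one, Finset.powerset_univ, Finset.card_univ, Fintype.card_fin] at h2
  simp only [Finset.card_empty, pow_zero] at h
  rw [add_comm 1 a, ← h2, ← h]
  ring

/-- Extension of a partial sequence by a constant. -/
def extendConst (T : Finset (Fin n)) (s₀ : S) (w : T → S) : Fin n → S :=
  fun i => if h : i ∈ T then w ⟨i, h⟩ else s₀

lemma measurable_extendConst (T : Finset (Fin n)) (s₀ : S) :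
    Measurable (extendConst T s₀) := by
  refine measurable_pi_lambda _ fun i => ?_
  by_cases h : i ∈ T
  · simpa [extendConst, h] using measurable_pi_apply (X := fun _ : T => S) ⟨i, h⟩
  · simp [extendConst, h]

omit [MeasurableSpace S] in
lemma extendConst_restrict {T : Finset (Fin n)} (s₀ : S) (f : Fin n → S) {i : Fin n}
    (h : i ∈ T) : extendConst T s₀ (fun j : T => f j) i = f i := by
  simp [extendConst, h]

variable [MeasurableSpace Ω] {μ : Measure Ω} [IsProbabilityMeasure μ] {ν : Measure S}
  [IsProbabilityMeasure ν] {X : Fin n → Ω → S}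

omit [IsProbabilityMeasure ν] in
lemma measureReal_tuple (hX : ∀ i, Measurable (X i)) (hind : iIndepFun X μ)
    (hlaw : ∀ i, μ.map (X i) = ν) {A : Set (Fin m → S)} (hA : MeasurableSet A)
    (α : Fin m ↪o Fin n) :
    μ.real {ω | (fun i => X (α i) ω) ∈ A} = (Measure.pi fun _ : Fin m => ν).real A := by
  have h1 : iIndepFun (fun i => X (α i)) μ := hind.precomp α.injective
  have h2 := (iIndepFun_iff_map_fun_eq_pi_map (fun i => (hX (α i)).aemeasurable)).1 h1
  simp_rw [hlaw] at h2
  rw [← h2, map_measureReal_apply (measurable_pi_lambda _ fun i => hX (α i)) hA]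
  rfl

/-- Given the coordinates in T, those in D are still independent with law ν, and each lies in the
R-section at `X b` with probability at most a. Fubini gives one factor a for each index of D. -/
lemma measureReal_inter_forall_le (hX : ∀ i, Measurable (X i)) (hind : iIndepFun X μ)
    (hlaw : ∀ i, μ.map (X i) = ν) {R : Set (S × S)} (hR : MeasurableSet R) {a : ℝ} (ha : 0 ≤ a)
    (hRa : ∀ x, ν {y | (x, y) ∈ R} ≤ ENNReal.ofReal a)
    {T D : Finset (Fin n)} (hTD : Disjoint T D) {b : Fin n} (hb : b ∈ T)
    {E : Set (T → S)} (hE : MeasurableSet E) :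
    μ.real {ω | (fun i : T => X i ω) ∈ E ∧ ∀ k ∈ D, (X b ω, X k ω) ∈ R}
      ≤ μ.real {ω | (fun i : T => X i ω) ∈ E} * a ^ D.card := by
  have hT : Measurable (fun ω (i : T) => X i ω) := measurable_pi_lambda _ fun i => hX i
  have hD : Measurable (fun ω (i : D) => X i ω) := measurable_pi_lambda _ fun i => hX i
  have hprod := (indepFun_iff_map_prod_eq_prod_map_map hT.aemeasurable hD.aemeasurable).1
    (hind.indepFun_finset T D hTD hX)
  have hDlaw : μ.map (fun ω (i : D) => X i ω) = Measure.pi fun _ : D => ν := by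
    have h1 : iIndepFun (fun i : D => X i) μ := hind.precomp Subtype.val_injective
    have h2 := (iIndepFun_iff_map_fun_eq_pi_map (fun i : D => (hX i).aemeasurable)).1 h1
    simpa only [hlaw] using h2
  set P : Set ((T → S) × (D → S)) := {z | z.1 ∈ E ∧ ∀ k, (z.1 ⟨b, hb⟩, z.2 k) ∈ R} with hP
  have hPm : MeasurableSet P := by
    have : P = (Prod.fst ⁻¹' E)
        ∩ ⋂ k, (fun z : (T → S) × (D → S) => (z.1 ⟨b, hb⟩, z.2 k)) ⁻¹' R := by
      ext; simp [hP]
    rw [this]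
    refine (measurable_fst hE).inter ?_
    refine MeasurableSet.iInter fun k => ?_
    have : Measurable fun z : (T → S) × (D → S) => (z.1 ⟨b, hb⟩, z.2 k) := by fun_prop
    exact this hR
  have e1 : μ {ω | (fun i : T => X i ω) ∈ E ∧ ∀ k ∈ D, (X b ω, X k ω) ∈ R}
      = (μ.map (fun ω => ((fun i : T => X i ω), fun i : D => X i ω))) P := by
    rw [Measure.map_apply (hT.prodMk hD) hPm]
    congr 1
    ext ω
    simp [hP]
  have e2 : μ {ω | (fun i : T => X i ω) ∈ E} = μ.map (fun ω (i : T) => X i ω) E := by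
    rw [Measure.map_apply hT hE]
    rfl
  have key : μ {ω | (fun i : T => X i ω) ∈ E ∧ ∀ k ∈ D, (X b ω, X k ω) ∈ R}
      ≤ μ {ω | (fun i : T => X i ω) ∈ E} * ENNReal.ofReal a ^ D.card := by
    rw [e1, hprod, hDlaw, Measure.prod_apply hPm, e2]
    calc _ ≤ ∫⁻ x, E.indicator (fun _ => ENNReal.ofReal a ^ D.card) x
            ∂(μ.map (fun ω (i : T) => X i ω)) := by
          refine lintegral_mono fun x => ?_
          by_cases hx : x ∈ E
          · rw [Set.indicator_of_mem hx]
            have : Prod.mk x ⁻¹' P = Set.univ.pi fun _ : D => {y | (x ⟨b, hb⟩, y) ∈ R} := by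
              ext z
              simp [hP, hx, Set.mem_pi]
            rw [this, Measure.pi_pi]
            refine (Finset.prod_le_prod' fun k _ => hRa (x ⟨b, hb⟩)).trans ?_
            simp
          · rw [Set.indicator_of_notMem hx]
            have : Prod.mk x ⁻¹' P = ∅ := by
              ext z
              simp [hP, hx]
            simp [this]
      _ = _ := by
          rw [lintegral_indicator_const hE, mul_comm]
  have := ENNReal.toReal_mono (by finiteness) key
  rwa [ENNReal.toReal_mul, ENNReal.toReal_pow, ENNReal.toReal_ofReal ha] at this

/-- Poisson approximation for the probability that no tuple drawn from an i.i.d. sequence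
belongs to a set `A` in which each coordinate nearly determines the others. -/
theorem abs_measureReal_forall_tuple_notMem_sub_exp_le (hm : 0 < m)
    (hX : ∀ i, Measurable (X i)) (hind : iIndepFun X μ)
    (hlaw : ∀ i, μ.map (X i) = ν) {R : Set (S × S)} (hR : MeasurableSet R)
    {a : ℝ} (ha : 0 ≤ a) (ha1 : a ≤ 1)
    (hRa : ∀ x, ν {y | (x, y) ∈ R} ≤ ENNReal.ofReal a)
    {A : Set (Fin m → S)} (hA : MeasurableSet A)
    (hAR : ∀ u ∈ A, ∀ i j, i ≠ j → (u i, u j) ∈ R) :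
    |μ.real {ω | ∀ α : Fin m ↪o Fin n, (fun i => X (α i) ω) ∉ A}
        - Real.exp (-(n.choose m * (Measure.pi fun _ : Fin m => ν).real A))| ≤
      n.choose m * (Measure.pi fun _ : Fin m => ν).real A *
        (2 ^ m * ((1 + a) ^ n - 1 + a ^ (m - 1)) + 2 ^ m * ((1 + a) ^ n - 1)) := by
  classical
  set q := (Measure.pi fun _ : Fin m => ν).real A with hq
  have hq0 : 0 ≤ q := measureReal_nonneg
  obtain ⟨s₀⟩ : Nonempty S := by
    by_contra h
    rw [not_nonempty_iff] at h
    have := measure_univ (μ := ν)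
    simp [Measure.eq_zero_of_isEmpty] at this
  set I : (Fin m ↪o Fin n) → Set Ω := fun α => {ω | (fun i => X (α i) ω) ∈ A} with hIdef
  have hI : ∀ α, MeasurableSet (I α) := fun α =>
    (measurable_pi_lambda _ fun i => hX (α i)) hA
  have hIq : ∀ α, μ.real (I α) = q := fun α => measureReal_tuple hX hind hlaw hA α
  have hN : ∀ α : Fin m ↪o Fin n, α ∈ overlapping α := by
    intro α
    simp only [overlapping, Finset.mem_filter, Finset.mem_univ, true_and, disjoint_self]
    intro h
    have := card_indexSet α
    rw [h] at this
    simp at this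
    omega
  have hcomp (T : Finset (Fin n)) : Measurable (fun w : T → S => extendConst T s₀ w) :=
    measurable_extendConst T s₀
  have htup (T : Finset (Fin n)) (α : Fin m ↪o Fin n) :
      MeasurableSet {w : T → S | (fun i => extendConst T s₀ w (α i)) ∈ A} := by
    have : Measurable fun w : T → S => fun i => extendConst T s₀ w (α i) :=
      measurable_pi_lambda _ fun i => (measurable_pi_apply (α i)).comp (hcomp T)
    exact this hA
  have htupX (T : Finset (Fin n)) (α : Fin m ↪o Fin n) (h : indexSet α ⊆ T) (ω : Ω) :
      (fun i => extendConst T s₀ (fun j : T => X j ω) (α i)) = fun i => X (α i) ω := by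
    ext i
    exact extendConst_restrict s₀ (fun j => X j ω) (h (mem_indexSet α i))
  -- The count over tuples disjoint from α depends only on the coordinates outside `indexSet α`.
  -- Padding with `s₀` expresses it as a function of those coordinates alone.
  have hindep : ∀ α (s : ℝ), ∫ ω in I α, s ^ countEvents I (overlapping α)ᶜ ω ∂μ
      = μ.real (I α) * ∫ ω, s ^ countEvents I (overlapping α)ᶜ ω ∂μ := by
    intro α s
    have hTD : Disjoint (indexSet α) (indexSet α)ᶜ := disjoint_compl_right
    have h0 := hind.indepFun_finset _ _ hTD hX
    set T := indexSet α with hT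
    set J : (Fin m ↪o Fin n) → Set ((Tᶜ : Finset (Fin n)) → S) :=
      fun β => {w | (fun i => extendConst Tᶜ s₀ w (β i)) ∈ A} with hJ
    have hV : ∀ ω, countEvents I (overlapping α)ᶜ ω
        = countEvents J (overlapping α)ᶜ (fun i : (Tᶜ : Finset (Fin n)) => X i ω) := by
      intro ω
      refine Finset.sum_congr rfl fun β hβ => ?_
      have hd : Disjoint (indexSet α) (indexSet β) := by
        simpa [overlapping] using hβ
      have hsub : indexSet β ⊆ Tᶜ := by
        rw [Finset.subset_compl_iff_disjoint_left]
        exact hd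
      have : ω ∈ I β ↔ (fun i : (Tᶜ : Finset (Fin n)) => X i ω) ∈ J β := by
        simp only [hJ, hIdef, Set.mem_ofPred_eq, htupX _ β hsub]
      by_cases h : ω ∈ I β
      · rw [Set.indicator_of_mem h, Set.indicator_of_mem (this.1 h)]
      · rw [Set.indicator_of_notMem h, Set.indicator_of_notMem (fun h' => h (this.2 h'))]
    have hG : Measurable fun w : (Tᶜ : Finset (Fin n)) → S =>
        s ^ countEvents J (overlapping α)ᶜ w := by
      have : Measurable fun k : ℕ => s ^ k := measurable_of_countable _
      exact this.comp (measurable_countEvents (fun β => htup _ β) _)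
    set E : Set (T → S) := {w | (fun i => extendConst T s₀ w (α i)) ∈ A} with hE
    have hEm : MeasurableSet E := htup T α
    have hF : Measurable (E.indicator fun _ => (1 : ℝ)) := measurable_const.indicator hEm
    have h1 := h0.comp hF hG
    have h2 := h1.integral_fun_mul_eq_mul_integral
      ((hF.comp
        (measurable_pi_lambda _ fun i : T => hX i)).aestronglyMeasurable)
      ((hG.comp (measurable_pi_lambda _ fun i : (Tᶜ : Finset (Fin n)) =>
        hX i)).aestronglyMeasurable)
    have hmem : ∀ ω, ω ∈ I α ↔ (fun i : T => X i ω) ∈ E := by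
      intro ω
      simp only [hE, hIdef, Set.mem_ofPred_eq, htupX T α subset_rfl]
    have hindic : ∀ ω, E.indicator (fun _ => (1 : ℝ)) (fun i : T => X i ω)
        = (I α).indicator (fun _ => 1) ω := by
      intro ω
      by_cases h : ω ∈ I α
      · rw [Set.indicator_of_mem h, Set.indicator_of_mem ((hmem ω).1 h)]
      · rw [Set.indicator_of_notMem h, Set.indicator_of_notMem (fun h' => h ((hmem ω).2 h'))]
    simp only [Function.comp_apply, hindic, ← hV] at h2
    rw [integral_indicator_const _ (hI α)] at h2
    rw [← integral_indicator (hI α)]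
    simp only [smul_eq_mul, mul_one] at h2
    rw [← h2]
    congr 1
    ext ω
    by_cases h : ω ∈ I α <;> simp [h]
  have main := abs_measureReal_forall_notMem_sub_exp_le μ hI hN hindep
  simp only [hIq, Finset.sum_const, Finset.card_univ, card_orderEmbedding, nsmul_eq_mul]
    at main
  refine main.trans ?_
  -- Conditionally on the tuple of α, a common index b forces every new index of β into the
  -- R-section at `X b`.
  have hpair : ∀ α β : Fin m ↪o Fin n, β ∈ overlapping α →
      μ.real (I α ∩ I β) ≤ q * a ^ (indexSet β \ indexSet α).card := by
    intro α β hβ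
    have : ¬ Disjoint (indexSet α) (indexSet β) := by
      simpa [overlapping] using hβ
    rw [Finset.not_disjoint_iff] at this
    obtain ⟨b, hbα, hbβ⟩ := this
    have h1 := measureReal_inter_forall_le hX hind hlaw hR ha hRa
      (T := indexSet α) (D := indexSet β \ indexSet α) Finset.disjoint_sdiff hbα
      (htup (indexSet α) α)
    simp only [Set.mem_ofPred_eq, htupX _ α subset_rfl] at h1
    rw [← hIq α]
    refine le_trans (measureReal_mono ?_) h1
    rintro ω ⟨hω1, hω2⟩
    refine ⟨hω1, fun k hk => ?_⟩
    rw [Finset.mem_sdiff] at hk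
    obtain ⟨i, rfl⟩ := exists_of_mem_indexSet hbβ
    obtain ⟨j, rfl⟩ := exists_of_mem_indexSet hk.1
    refine hAR _ hω2 i j ?_
    rintro rfl
    exact hk.2 hbα
  -- The same bound with a single base index. A tuple must exist because q is estimated through the
  -- variables X.
  have hqa : (Nonempty (Fin m ↪o Fin n)) → q ≤ a ^ (m - 1) := by
    rintro ⟨α⟩
    have hD : (indexSet α \ {α ⟨0, hm⟩}).card = m - 1 := by
      rw [Finset.card_sdiff_of_subset (by simpa using mem_indexSet α _), card_indexSet]
      simp
    have h1 := measureReal_inter_forall_le hX hind hlaw hR ha hRa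
      (T := {α ⟨0, hm⟩}) (D := indexSet α \ {α ⟨0, hm⟩}) Finset.disjoint_sdiff
      (Finset.mem_singleton_self _) MeasurableSet.univ
    rw [hD] at h1
    rw [← hIq α]
    refine le_trans (measureReal_mono ?_) (h1.trans ?_)
    · intro ω hω
      refine ⟨trivial, fun k hk => ?_⟩
      rw [Finset.mem_sdiff, Finset.mem_singleton] at hk
      obtain ⟨j, rfl⟩ := exists_of_mem_indexSet hk.1
      exact hAR _ hω _ _ fun h => hk.2 (by rw [h])
    · simp
  have hE0 : ∀ α β : Fin m ↪o Fin n, β ≠ α →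
      indexSet β \ indexSet α ∈ (Finset.univ : Finset (Finset (Fin n))).erase ∅ := by
    intro α β hβ
    rw [Finset.mem_erase]
    refine ⟨fun h => hβ ?_, Finset.mem_univ _⟩
    rw [Finset.sdiff_eq_empty_iff_subset] at h
    exact indexSet_injective (Finset.eq_of_subset_of_card_le h (by simp [card_indexSet]))
  have hcard : ∀ α β : Fin m ↪o Fin n, β ∈ overlapping α →
      (indexSet β \ indexSet α).card ≤ m - 1 := by
    intro α β hβ
    have hβ' : ¬ Disjoint (indexSet α) (indexSet β) := by
      simpa [overlapping] using hβ
    have h1 := Finset.card_sdiff_add_card_inter (indexSet β) (indexSet α)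
    rw [card_indexSet] at h1
    have : 0 < (indexSet β ∩ indexSet α).card := by
      rw [Finset.card_pos, Finset.inter_comm]
      exact Finset.not_disjoint_iff_nonempty_inter.1 hβ'
    omega
  have hsum2 : ∀ α : Fin m ↪o Fin n, ∑ β ∈ (overlapping α).erase α,
      a ^ (indexSet β \ indexSet α).card ≤ 2 ^ m * ((1 + a) ^ n - 1) := by
    intro α
    rw [← sum_pow_card_nonempty]
    exact sum_overlapping_le α (fun E => a ^ E.card) (fun E => by positivity) _ _
      fun β hβ => hE0 α β (Finset.ne_of_mem_erase hβ)
  -- An overlapping β ≠ α has between 1 and m - 1 new indices, so q ≤ a ^ (m - 1) is dominated by a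
  -- to that number and the previous sum applies. The term β = α is the extra a ^ (m - 1).
  have hsum1 : ∀ α : Fin m ↪o Fin n, ∑ β ∈ overlapping α, q
      ≤ 2 ^ m * ((1 + a) ^ n - 1 + a ^ (m - 1)) := by
    intro α
    have hqα := hqa ⟨α⟩
    rw [← Finset.sum_erase_add _ _ (hN α), mul_add]
    refine add_le_add (le_trans (Finset.sum_le_sum fun β hβ => ?_) (hsum2 α)) ?_
    · exact hqα.trans
        (pow_le_pow_of_le_one ha ha1 (hcard α β (Finset.mem_of_mem_erase hβ)))
    · refine hqα.trans (le_mul_of_one_le_left (by positivity) ?_)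
      exact one_le_pow₀ (by norm_num)
  have hfin : ∀ α : Fin m ↪o Fin n, ∑ β ∈ overlapping α, q * q
      + ∑ β ∈ (overlapping α).erase α, μ.real (I α ∩ I β)
      ≤ q * (2 ^ m * ((1 + a) ^ n - 1 + a ^ (m - 1)) + 2 ^ m * ((1 + a) ^ n - 1)) := by
    intro α
    rw [mul_add, ← Finset.mul_sum]
    refine add_le_add (mul_le_mul_of_nonneg_left (hsum1 α) hq0) ?_
    refine le_trans (Finset.sum_le_sum fun β hβ => hpair α β (Finset.mem_of_mem_erase hβ)) ?_
    rw [← Finset.mul_sum]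
    exact mul_le_mul_of_nonneg_left (hsum2 α) hq0
  calc _ ≤ ∑ α : Fin m ↪o Fin n, q * (2 ^ m * ((1 + a) ^ n - 1 + a ^ (m - 1))
          + 2 ^ m * ((1 + a) ^ n - 1)) := Finset.sum_le_sum fun α _ => by
            simpa using hfin α
    _ = _ := by
        simp only [Finset.sum_const, Finset.card_univ, card_orderEmbedding, nsmul_eq_mul]
        ring

end IID

/-! ### The kernel as a function of polar angles -/

section Kernel

/-- The `2π`-periodic extension of `g` from `[0, 2π)`. -/
def periodicExt (g : ℝ → ℝ) (x : ℝ) : ℝ := g (toIcoMod Real.two_pi_pos 0 x)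

lemma periodicExt_periodic (g : ℝ → ℝ) : Function.Periodic (periodicExt g) (2 * Real.pi) := by
  intro x
  simp [periodicExt]

lemma periodicExt_eq {g : ℝ → ℝ} (hg : g 0 = g (2 * Real.pi)) {x : ℝ}
    (hx : x ∈ Set.Icc 0 (2 * Real.pi)) : periodicExt g x = g x := by
  rcases eq_or_lt_of_le hx.2 with rfl | h
  · rw [← hg, periodicExt]
    congr 1
    simpa using toIcoMod_apply_right Real.two_pi_pos 0
  · rw [periodicExt, (toIcoMod_eq_self Real.two_pi_pos).2 ⟨hx.1, by simpa using h⟩]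

lemma periodicExt_neg {g : ℝ → ℝ} (hg : ∀ x ∈ Set.Icc 0 (2 * Real.pi), g x = g (2 * Real.pi - x))
    (x : ℝ) : periodicExt g (-x) = periodicExt g x := by
  have h0 : g 0 = g (2 * Real.pi) := by
    simpa using hg 0 ⟨le_rfl, Real.two_pi_pos.le⟩
  have hmem := toIcoMod_mem_Ico Real.two_pi_pos 0 x
  simp only [zero_add] at hmem
  have e : -x = (2 * Real.pi - toIcoMod Real.two_pi_pos 0 x)
      - (toIcoDiv Real.two_pi_pos 0 x + 1) • (2 * Real.pi) := by
    have := toIcoMod_add_toIcoDiv_zsmul Real.two_pi_pos 0 x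
    rw [add_zsmul, one_zsmul]
    linarith
  rw [e, (periodicExt_periodic g).sub_zsmul_eq,
    periodicExt_eq h0 ⟨by linarith [hmem.2], by linarith [hmem.1]⟩, ← hg _ ⟨hmem.1, hmem.2.le⟩]
  rfl

lemma continuous_periodicExt {g : ℝ → ℝ} (hc : ContinuousOn g (Set.Icc 0 (2 * Real.pi)))
    (hg : g 0 = g (2 * Real.pi)) : Continuous (periodicExt g) := by
  have : Fact (0 < 2 * Real.pi) := ⟨Real.two_pi_pos⟩
  have h1 := AddCircle.liftIco_zero_continuous hg hc
  have h2 : periodicExt g = (AddCircle.liftIco (2 * Real.pi) 0 g)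
      ∘ ((↑) : ℝ → AddCircle (2 * Real.pi)) := by
    ext x
    have hmem := toIcoMod_mem_Ico Real.two_pi_pos 0 x
    have e : ((x : ℝ) : AddCircle (2 * Real.pi)) = (toIcoMod Real.two_pi_pos 0 x : ℝ) := by
      rw [← self_sub_toIcoDiv_zsmul, AddCircle.coe_sub, AddCircle.coe_zsmul,
        AddCircle.coe_period, smul_zero, sub_zero]
    rw [Function.comp_apply, e, AddCircle.liftIco_coe_apply hmem]
    rfl
  rw [h2]
  exact h1.comp (AddCircle.continuous_mk' _)

variable {m : ℕ}

/-- The sum of `h` over the pairwise differences of the coordinates. -/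
def pairSum (h : ℝ → ℝ) (θ : Fin m → ℝ) : ℝ := ∑ i, ∑ j ∈ Finset.Ioi i, h (θ j - θ i)

lemma two_mul_sum_Ioi (a : Fin m → Fin m → ℝ) (ha : ∀ i j, a i j = a j i) :
    2 * ∑ i, ∑ j ∈ Finset.Ioi i, a i j = ∑ i, ∑ j, a i j - ∑ i, a i i := by
  have h1 : ∀ i : Fin m, ∑ j, a i j
      = ∑ j ∈ Finset.Iio i, a i j + a i i + ∑ j ∈ Finset.Ioi i, a i j := by
    intro i
    rw [← Finset.sum_filter_add_sum_filter_not Finset.univ (fun j => j ≤ i)]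
    congr 1
    · rw [show (Finset.univ.filter fun j => j ≤ i) = Finset.Iic i by ext; simp,
        ← Finset.Iio_insert, Finset.sum_insert (by simp), add_comm]
    · refine Finset.sum_congr ?_ fun _ _ => rfl
      ext; simp
  have h2 : ∑ i, ∑ j ∈ Finset.Iio i, a i j = ∑ i, ∑ j ∈ Finset.Ioi i, a i j := by
    rw [Finset.sum_comm' (t' := Finset.univ) (s' := fun j => Finset.Ioi j) (by simp)]
    exact Finset.sum_congr rfl fun i _ => Finset.sum_congr rfl fun j _ => ha _ _
  simp_rw [h1, Finset.sum_add_distrib, h2]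
  ring

variable {h : ℝ → ℝ}

/-- Summing over all ordered pairs makes invariance under relabelling and cyclic sums visible, at
the price of the diagonal term. -/
lemma two_mul_pairSum (heven : ∀ x, h (-x) = h x) (θ : Fin m → ℝ) :
    2 * pairSum h θ = ∑ i, ∑ j, h (θ j - θ i) - m * h 0 := by
  rw [pairSum, two_mul_sum_Ioi _ fun i j => by rw [← heven, neg_sub]]
  simp

lemma pairSum_comp_perm (heven : ∀ x, h (-x) = h x) (θ : Fin m → ℝ) (σ : Equiv.Perm (Fin m)) :
    pairSum h (fun i => θ (σ i)) = pairSum h θ := by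
  have h1 := two_mul_pairSum heven θ
  have h2 := two_mul_pairSum heven fun i => θ (σ i)
  have h3 : ∑ i, ∑ j, h (θ (σ j) - θ (σ i)) = ∑ i, ∑ j, h (θ j - θ i) := by
    rw [← Equiv.sum_comp σ fun i => ∑ j, h (θ j - θ i)]
    exact Finset.sum_congr rfl fun i _ => Equiv.sum_comp σ fun j => h (θ j - θ (σ i))
  rw [h3] at h2
  linarith

lemma pairSum_add_const (θ : Fin m → ℝ) (c : ℝ) :
    pairSum h (fun i => θ i + c) = pairSum h θ := by
  simp [pairSum]

lemma pairSum_congr_of_periodic (hper : Function.Periodic h (2 * Real.pi)) {θ θ' : Fin m → ℝ}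
    (hθ : ∀ i, ∃ k : ℤ, θ' i = θ i + k * (2 * Real.pi)) : pairSum h θ' = pairSum h θ := by
  choose k hk using hθ
  refine Finset.sum_congr rfl fun i _ => Finset.sum_congr rfl fun j _ => ?_
  rw [hk, hk, show θ j + k j * (2 * Real.pi) - (θ i + k i * (2 * Real.pi))
    = θ j - θ i + ((k j - k i : ℤ) : ℝ) * (2 * Real.pi) by push_cast; ring]
  exact hper.int_mul _ _

lemma continuous_pairSum (hh : Continuous h) : Continuous (pairSum h : (Fin m → ℝ) → ℝ) := by
  unfold pairSum
  fun_prop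

lemma exists_int_ccwAngle_exp (x y : ℝ) :
    ∃ k : ℤ, ccwAngle (Circle.exp x) (Circle.exp y) = y - x + k * (2 * Real.pi) := by
  have h1 : (Circle.exp y / Circle.exp x : Circle) = Circle.exp (y - x) := by
    rw [Circle.exp_sub]
  obtain ⟨k, hk⟩ : ∃ k : ℤ, Complex.arg ((Circle.exp (y - x) : Circle) : ℂ)
      = y - x + k * (2 * Real.pi) := by
    have h2 : Circle.exp (Complex.arg ((Circle.exp (y - x) : Circle) : ℂ))
        = Circle.exp (y - x) := Circle.exp_arg _
    obtain ⟨k, hk⟩ := Circle.exp_eq_exp.1 h2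
    exact ⟨k, hk⟩
  refine ⟨k - toIcoDiv Real.two_pi_pos 0 (Complex.arg ((Circle.exp (y - x) : Circle) : ℂ)), ?_⟩
  have h3 := toIcoMod_add_toIcoDiv_zsmul Real.two_pi_pos 0
    (Complex.arg ((Circle.exp (y - x) : Circle) : ℂ))
  rw [ccwAngle, h1]
  rw [zsmul_eq_mul, hk] at h3
  rw [hk, Int.cast_sub]
  linarith

/-- All |β_j - β_i| lie in [0, 2π], where the extension agrees with g, and evenness removes the
absolute value. The central angles are θ_i - θ_0 modulo 2π, a rotation that `pairSum` ignores. -/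
lemma kernel_exp [NeZero m] {g : ℝ → ℝ}
    (hg : ∀ x ∈ Set.Icc 0 (2 * Real.pi), g x = g (2 * Real.pi - x)) (θ : Fin m → ℝ) :
    kernel g (fun i => Circle.exp (θ i)) = pairSum (periodicExt g) θ := by
  have h0 : g 0 = g (2 * Real.pi) := by
    simpa using hg 0 ⟨le_rfl, Real.two_pi_pos.le⟩
  have h1 : kernel g (fun i => Circle.exp (θ i))
      = pairSum (periodicExt g) (centralAngle fun i => Circle.exp (θ i)) := by
    refine Finset.sum_congr rfl fun i _ => Finset.sum_congr rfl fun j _ => ?_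
    have hi := toIcoMod_mem_Ico Real.two_pi_pos 0
      (Complex.arg ((Circle.exp (θ i) / Circle.exp (θ 0) : Circle) : ℂ))
    have hj := toIcoMod_mem_Ico Real.two_pi_pos 0
      (Complex.arg ((Circle.exp (θ j) / Circle.exp (θ 0) : Circle) : ℂ))
    simp only [zero_add] at hi hj
    have hle : |centralAngle (fun i => Circle.exp (θ i)) j
        - centralAngle (fun i => Circle.exp (θ i)) i| ≤ 2 * Real.pi := by
      rw [abs_le]
      simp only [centralAngle, ccwAngle]
      constructor <;> linarith [hi.1, hi.2, hj.1, hj.2]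
    rw [← periodicExt_eq h0 ⟨abs_nonneg _, hle⟩]
    rcases abs_choice (centralAngle (fun i => Circle.exp (θ i)) j
      - centralAngle (fun i => Circle.exp (θ i)) i) with h | h <;> rw [h]
    exact periodicExt_neg hg _
  rw [h1, ← pairSum_add_const θ (-θ 0)]
  refine pairSum_congr_of_periodic (periodicExt_periodic g) fun i => ?_
  exact exists_int_ccwAngle_exp (θ 0) (θ i)

/-- A shift by `a` does not change a sum over a period. -/
lemma sum_range_add_of_periodic {c : ℤ → ℝ} (hc : ∀ s, c (s + m) = c s) (a : ℤ) :
    ∑ j ∈ Finset.range m, c (j + a) = ∑ j ∈ Finset.range m, c j := by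
  have step : ∀ a : ℤ, ∑ j ∈ Finset.range m, c (j + (a + 1))
      = ∑ j ∈ Finset.range m, c (j + a) := by
    intro a
    have h1 := Finset.sum_range_succ (fun j : ℕ => c (j + a)) m
    have h2 := Finset.sum_range_succ' (fun j : ℕ => c (j + a)) m
    have h3 : c (m + a) = c a := by rw [add_comm]; exact hc a
    have h4 : ∀ j : ℕ, c (((j + 1 : ℕ) : ℤ) + a) = c (j + (a + 1)) := by
      intro j; congr 1; push_cast; ring
    simp only [h4, Nat.cast_zero, zero_add] at h2
    linarith
  induction a using Int.induction_on with
  | zero => simp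
  | succ i ih => rw [step, ih]
  | pred i ih => rw [← ih, ← step]; simp

lemma sum_fin_sub_of_periodic {c : ℤ → ℝ} (hc : ∀ s, c (s + m) = c s) (i : Fin m) :
    ∑ j : Fin m, c ((j : ℕ) - (i : ℕ)) = ∑ j ∈ Finset.range m, c j := by
  rw [← sum_range_add_of_periodic hc (-((i : ℕ) : ℤ)), Finset.sum_range]
  rfl

/-- The polar angles of the vertices of the regular polygon that starts at angle `0`. -/
def regularAngles (m : ℕ) (i : Fin m) : ℝ := 2 * Real.pi * (i : ℕ) / m

/-- Every vertex sees the same differences modulo 2π, so each row of the double sum is the sum over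
one period. -/
lemma pairSum_regularAngles {g : ℝ → ℝ} (hm : 0 < m)
    (hg : ∀ x ∈ Set.Icc 0 (2 * Real.pi), g x = g (2 * Real.pi - x)) :
    pairSum (periodicExt g) (regularAngles m)
      = 1 / 2 * ∑ s ∈ Finset.Icc 1 (m - 1), (m : ℝ) * g (2 * Real.pi * s / m) := by
  have hm' : (m : ℝ) ≠ 0 := by positivity
  have h0 : g 0 = g (2 * Real.pi) := by
    simpa using hg 0 ⟨le_rfl, Real.two_pi_pos.le⟩
  have h1 := two_mul_pairSum (periodicExt_neg hg) (regularAngles m)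
  set c : ℤ → ℝ := fun s => periodicExt g (2 * Real.pi * s / m) with hc
  have hcper : ∀ s, c (s + m) = c s := by
    intro s
    simp only [hc]
    rw [show (2 * Real.pi * ((s + m : ℤ) : ℝ) / m) = 2 * Real.pi * s / m + 2 * Real.pi by
      push_cast; field_simp]
    exact periodicExt_periodic g _
  have h2 : ∀ i : Fin m, ∑ j : Fin m, periodicExt g (regularAngles m j - regularAngles m i)
      = ∑ s ∈ Finset.range m, c s := by
    intro i
    rw [← sum_fin_sub_of_periodic hcper i]
    refine Finset.sum_congr rfl fun j _ => ?_
    simp only [hc, regularAngles]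
    congr 1
    push_cast
    ring
  simp only [h2, Finset.sum_const, Finset.card_univ, Fintype.card_fin, nsmul_eq_mul] at h1
  have h3 : ∑ s ∈ Finset.range m, c s = periodicExt g 0
      + ∑ s ∈ Finset.Icc 1 (m - 1), g (2 * Real.pi * s / m) := by
    obtain ⟨k, rfl⟩ : ∃ k, m = k + 1 := ⟨m - 1, by omega⟩
    rw [Finset.sum_range_succ', add_comm]
    congr 1
    · simp [hc]
    · rw [Nat.add_sub_cancel, Finset.range_eq_Ico, Finset.sum_Ico_add' (fun s : ℕ => c s) 0 k 1]
      refine Finset.sum_congr (by ext; simp) fun s hs => ?_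
      simp only [hc, Int.cast_natCast]
      refine periodicExt_eq h0 ⟨by positivity, ?_⟩
      rw [Finset.mem_Icc] at hs
      have : (s : ℝ) ≤ ((k + 1 : ℕ) : ℝ) := by exact_mod_cast (by omega)
      rw [div_le_iff₀ (by positivity)]
      nlinarith [Real.pi_pos]
  rw [h3] at h1
  rw [← Finset.mul_sum]
  linarith

end Kernel

/-! ### Second order expansion at the regular polygon -/

section Hessian

open Matrix

/-- Taylor's formula on a small ball, on which derivatives within the ball are ordinary derivatives.
-/
lemma isLittleO_taylor_two {h : ℝ → ℝ} {a : ℝ} (hh : ContDiffAt ℝ 2 h a) :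
    (fun x => h (a + x) - h a - deriv h a * x - iteratedDeriv 2 h a / 2 * x ^ 2)
      =o[𝓝 0] fun x => x ^ 2 := by
  obtain ⟨u, hu, hcu⟩ := hh.contDiffOn le_rfl (by simp)
  obtain ⟨ε, hε, hball⟩ := Metric.mem_nhds_iff.1 hu
  have hc : ContDiffOn ℝ (2 : ℕ) h (Metric.ball a ε) := hcu.mono hball
  have ha : a ∈ Metric.ball a ε := Metric.mem_ball_self hε
  have h1 := taylor_isLittleO (convex_ball a ε) ha hc
  rw [Metric.isOpen_ball.nhdsWithin_eq ha] at h1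
  have hlim : Tendsto (fun x => a + x) (𝓝 0) (𝓝 a) := by
    have : Continuous fun x : ℝ => a + x := by fun_prop
    simpa using this.tendsto 0
  have h2 := h1.comp_tendsto hlim
  have e1 : iteratedDerivWithin 1 h (Metric.ball a ε) a = deriv h a := by
    rw [iteratedDerivWithin_of_isOpen Metric.isOpen_ball ha, iteratedDeriv_one]
  have e2 : iteratedDerivWithin 2 h (Metric.ball a ε) a = iteratedDeriv 2 h a :=
    iteratedDerivWithin_of_isOpen Metric.isOpen_ball ha
  refine (h2.congr' (Eventually.of_forall fun x => ?_) (Eventually.of_forall fun x => ?_))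
  · simp only [Function.comp_apply, taylorWithinEval_succ, taylor_within_zero_eval, zero_add, e1,
      one_add_one_eq_two, e2]
    simp
    ring
  · simp

variable {k : ℕ}

/-- The point of `ℝ^{k+1}` whose first coordinate is zero. -/
def consZero (y : Fin k → ℝ) : Fin (k + 1) → ℝ := Fin.cons 0 y

@[simp] lemma consZero_zero (y : Fin k → ℝ) : consZero y 0 = 0 := rfl

@[simp] lemma consZero_succ (y : Fin k → ℝ) (i : Fin k) : consZero y i.succ = y i := rfl

lemma consZero_add (y z : Fin k → ℝ) (i : Fin (k + 1)) :
    consZero (y + z) i = consZero y i + consZero z i := by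
  refine Fin.cases ?_ (fun i => ?_) i <;> simp

lemma consZero_smul (r : ℝ) (y : Fin k → ℝ) (i : Fin (k + 1)) :
    consZero (r • y) i = r * consZero y i := by
  refine Fin.cases ?_ (fun i => ?_) i <;> simp

lemma continuous_consZero : Continuous (consZero : (Fin k → ℝ) → Fin (k + 1) → ℝ) := by
  refine continuous_pi fun i => ?_
  refine Fin.cases ?_ (fun i => ?_) i
  · simpa using continuous_const
  · simpa using continuous_apply i

lemma abs_consZero_le (y : Fin k → ℝ) (i : Fin (k + 1)) : |consZero y i| ≤ ‖y‖ := by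
  refine Fin.cases ?_ (fun i => ?_) i
  · simp
  · simpa using norm_le_pi_norm y i

/-- The values of the second derivative of `h` at the angles of the regular `m`-gon. -/
def secondDerivAt (h : ℝ → ℝ) (m : ℕ) (s : ℤ) : ℝ := iteratedDeriv 2 h (2 * Real.pi * s / m)

lemma secondDerivAt_add {h : ℝ → ℝ} (hper : Function.Periodic h (2 * Real.pi)) {m : ℕ}
    (hm : 0 < m) (s : ℤ) : secondDerivAt h m (s + m) = secondDerivAt h m s := by
  have hm' : (m : ℝ) ≠ 0 := by positivity
  have h1 := congrFun (iteratedDeriv_comp_add_const 2 h (2 * Real.pi)) (2 * Real.pi * s / m)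
  have h2 : (fun z => h (z + 2 * Real.pi)) = h := funext hper
  rw [h2] at h1
  rw [secondDerivAt, secondDerivAt, h1]
  congr 1
  push_cast
  field_simp

lemma secondDerivAt_neg {h : ℝ → ℝ} (heven : ∀ x, h (-x) = h x) {m : ℕ} (s : ℤ) :
    secondDerivAt h m (-s) = secondDerivAt h m s := by
  have h1 := iteratedDeriv_comp_neg 2 h (2 * Real.pi * s / m)
  have h2 : (fun z => h (-z)) = h := funext heven
  rw [h2] at h1
  rw [secondDerivAt, secondDerivAt, h1]
  simp [neg_div]

/-- Second order expansion of `pairSum` at the regular polygon. -/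
lemma exists_isLittleO_pairSum {h : ℝ → ℝ}
    (hs : ∀ s ∈ Finset.Icc 1 k, ContDiffAt ℝ 2 h (2 * Real.pi * s / (k + 1 : ℕ))) :
    ∃ L : (Fin k → ℝ) →L[ℝ] ℝ,
      (fun y : Fin k → ℝ => pairSum h (fun i => regularAngles (k + 1) i + consZero y i)
        - pairSum h (regularAngles (k + 1)) - L y
        - 1 / 2 * ∑ i : Fin (k + 1), ∑ j ∈ Finset.Ioi i,
          secondDerivAt h (k + 1) ((j : ℕ) - (i : ℕ)) * (consZero y j - consZero y i) ^ 2)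
      =o[𝓝 0] fun y => ‖y‖ ^ 2 := by
  set P := regularAngles (k + 1) with hP
  set d : Fin (k + 1) → Fin (k + 1) → (Fin k → ℝ) →ₗ[ℝ] ℝ := fun i j =>
    { toFun := fun y => consZero y j - consZero y i
      map_add' := fun y z => by simp only [consZero_add]; ring
      map_smul' := fun r y => by simp only [consZero_smul, RingHom.id_apply, smul_eq_mul]; ring }
    with hd
  have hdc : ∀ i j, Continuous (d i j) := fun i j => LinearMap.continuous_of_finiteDimensional _
  refine ⟨LinearMap.toContinuousLinearMap
    (∑ i, ∑ j ∈ Finset.Ioi i, deriv h (P j - P i) • d i j), ?_⟩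
  have key : ∀ i : Fin (k + 1), ∀ j ∈ Finset.Ioi i,
      (fun y => h (P j - P i + d i j y) - h (P j - P i) - deriv h (P j - P i) * d i j y
        - iteratedDeriv 2 h (P j - P i) / 2 * (d i j y) ^ 2) =o[𝓝 0] fun y => ‖y‖ ^ 2 := by
    -- Only the differences 2πs/(k+1) with 1 ≤ s ≤ k occur, so no smoothness of h at 0 is needed.
    intro i j hij
    have hlt : (i : ℕ) < j := by simpa using hij
    have hPij : P j - P i = 2 * Real.pi * ((j - i : ℕ) : ℝ) / (k + 1 : ℕ) := by
      simp only [hP, regularAngles]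
      rw [Nat.cast_sub hlt.le]
      ring
    have hcd : ContDiffAt ℝ 2 h (P j - P i) := by
      rw [hPij]
      refine hs _ (Finset.mem_Icc.2 ⟨by omega, ?_⟩)
      have := j.2
      omega
    have hlim : Tendsto (d i j) (𝓝 0) (𝓝 0) := by
      simpa using (hdc i j).tendsto 0
    have h1 := (isLittleO_taylor_two hcd).comp_tendsto hlim
    refine h1.trans_isBigO ?_
    refine Asymptotics.IsBigO.of_bound 4 (Eventually.of_forall fun y => ?_)
    have h2 : |d i j y| ≤ 2 * ‖y‖ := by
      have := abs_sub (consZero y j) (consZero y i)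
      have h3 := abs_consZero_le y i
      have h4 := abs_consZero_le y j
      simp only [hd, LinearMap.coe_mk, AddHom.coe_mk]
      linarith
    simp only [Function.comp_apply, norm_pow, Real.norm_eq_abs, abs_norm]
    calc |d i j y| ^ 2 ≤ (2 * ‖y‖) ^ 2 := by gcongr
      _ = _ := by ring
  have hsum := Asymptotics.IsLittleO.sum (s := Finset.univ) fun i _ =>
    Asymptotics.IsLittleO.sum (s := Finset.Ioi i) fun j hj => key i j hj
  refine hsum.congr_left fun y => ?_
  have hL : (LinearMap.toContinuousLinearMap
      (∑ i, ∑ j ∈ Finset.Ioi i, deriv h (P j - P i) • d i j)) y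
      = ∑ i, ∑ j ∈ Finset.Ioi i, deriv h (P j - P i) * d i j y := by
    simp
  rw [hL, pairSum, pairSum, Finset.mul_sum, ← Finset.sum_sub_distrib, ← Finset.sum_sub_distrib,
    ← Finset.sum_sub_distrib, Finset.sum_apply]
  refine Finset.sum_congr rfl fun i _ => ?_
  rw [Finset.sum_apply, Finset.mul_sum, ← Finset.sum_sub_distrib, ← Finset.sum_sub_distrib,
    ← Finset.sum_sub_distrib]
  refine Finset.sum_congr rfl fun j _ => ?_
  have e1 : secondDerivAt h (k + 1) ((j : ℕ) - (i : ℕ)) = iteratedDeriv 2 h (P j - P i) := by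
    rw [secondDerivAt]
    congr 1
    simp only [hP, regularAngles]
    push_cast
    ring
  have e2 : d i j y = consZero y j - consZero y i := rfl
  rw [e1, e2, show P j + consZero y j - (P i + consZero y i)
    = P j - P i + (consZero y j - consZero y i) by ring]
  ring

/-- The Toeplitz matrix `G`, written with a function on the line instead of `g`. -/
lemma sum_secondDerivAt_mul_sq {h : ℝ → ℝ} (heven : ∀ x, h (-x) = h x)
    (hper : Function.Periodic h (2 * Real.pi)) {G : Matrix (Fin k) (Fin k) ℝ}
    (hG : ∀ i j, G i j = if i = j then ∑ s ∈ Finset.Icc 1 k, secondDerivAt h (k + 1) s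
      else -secondDerivAt h (k + 1) ((j : ℕ) - (i : ℕ))) (y : Fin k → ℝ) :
    ∑ i : Fin (k + 1), ∑ j ∈ Finset.Ioi i,
          secondDerivAt h (k + 1) ((j : ℕ) - (i : ℕ)) * (consZero y j - consZero y i) ^ 2
      = y ⬝ᵥ (G *ᵥ y) := by
  set c := secondDerivAt h (k + 1) with hc
  set z := consZero y with hz
  have hcper : ∀ s, c (s + (k + 1 : ℕ)) = c s := secondDerivAt_add hper (Nat.succ_pos k)
  have hcneg : ∀ s, c (-s) = c s := secondDerivAt_neg heven
  -- Over ordered pairs the square can be expanded: by periodicity all row and column sums of c(j -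
  -- i) equal S'.
  have h1 := two_mul_sum_Ioi
    (fun i j : Fin (k + 1) => c ((j : ℕ) - (i : ℕ)) * (z j - z i) ^ 2) fun i j => by
      rw [← hcneg, neg_sub]; ring
  simp only [sub_self, ne_eq, OfNat.ofNat_ne_zero, not_false_eq_true, zero_pow, mul_zero,
    Finset.sum_const_zero, sub_zero] at h1
  set S' := ∑ s ∈ Finset.range (k + 1), c s with hS'
  have hS1 : ∀ i : Fin (k + 1), ∑ j : Fin (k + 1), c ((j : ℕ) - (i : ℕ)) = S' := fun i =>
    sum_fin_sub_of_periodic hcper i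
  have hS2 : ∀ j : Fin (k + 1), ∑ i : Fin (k + 1), c ((j : ℕ) - (i : ℕ)) = S' := fun j => by
    rw [← hS1 j]
    exact Finset.sum_congr rfl fun i _ => by rw [← hcneg, neg_sub]
  have h2 : ∑ i : Fin (k + 1), ∑ j : Fin (k + 1), c ((j : ℕ) - (i : ℕ)) * (z j - z i) ^ 2
      = 2 * (S' * ∑ i, z i ^ 2)
        - 2 * ∑ i : Fin (k + 1), ∑ j : Fin (k + 1), c ((j : ℕ) - (i : ℕ)) * (z i * z j) := by
    have e1 : ∑ i : Fin (k + 1), ∑ j : Fin (k + 1), c ((j : ℕ) - (i : ℕ)) * z j ^ 2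
        = S' * ∑ i, z i ^ 2 := by
      rw [Finset.sum_comm, Finset.mul_sum]
      exact Finset.sum_congr rfl fun j _ => by rw [← Finset.sum_mul, hS2]
    have e2 : ∑ i : Fin (k + 1), ∑ j : Fin (k + 1), c ((j : ℕ) - (i : ℕ)) * z i ^ 2
        = S' * ∑ i, z i ^ 2 := by
      rw [Finset.mul_sum]
      exact Finset.sum_congr rfl fun i _ => by rw [← Finset.sum_mul, hS1]
    have e3 : ∀ i j : Fin (k + 1), c ((j : ℕ) - (i : ℕ)) * (z j - z i) ^ 2
        = c ((j : ℕ) - (i : ℕ)) * z j ^ 2 + c ((j : ℕ) - (i : ℕ)) * z i ^ 2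
          - 2 * (c ((j : ℕ) - (i : ℕ)) * (z i * z j)) := fun i j => by ring
    simp_rw [e3, Finset.sum_sub_distrib, Finset.sum_add_distrib, ← Finset.mul_sum, e1, e2]
    ring
  -- Since z_0 = 0, the first row and column drop out, which reduces the form to k variables.
  have h3 : ∑ i : Fin (k + 1), ∑ j : Fin (k + 1), c ((j : ℕ) - (i : ℕ)) * (z i * z j)
      = ∑ i : Fin k, ∑ j : Fin k, c ((j : ℕ) - (i : ℕ)) * (y i * y j) := by
    rw [Fin.sum_univ_succ]
    simp only [hz, consZero_zero, zero_mul, mul_zero, Finset.sum_const_zero, zero_add]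
    refine Finset.sum_congr rfl fun i _ => ?_
    rw [Fin.sum_univ_succ]
    simp
  have h4 : ∑ i, z i ^ 2 = ∑ i, y i ^ 2 := by
    rw [Fin.sum_univ_succ]
    simp [hz]
  have h5 : S' = c 0 + ∑ s ∈ Finset.Icc 1 k, c s := by
    rw [hS', Finset.sum_range_succ', add_comm]
    congr 1
    rw [Finset.range_eq_Ico, Finset.sum_Ico_add' (fun s : ℕ => c s) 0 k 1]
    exact Finset.sum_congr (by ext; simp) fun _ _ => rfl
  -- c 0 comes from the second derivative of h at 0, which need not exist. It enters both S' and the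
  -- diagonal products, and cancels.
  have h6 : ∀ i j : Fin k, y i * (G i j * y j)
      = -(c ((j : ℕ) - (i : ℕ)) * (y i * y j)) + if i = j then S' * y i ^ 2 else 0 := by
    intro i j
    rw [hG]
    by_cases hij : i = j
    · subst hij
      simp only [if_true, sub_self, h5]
      ring
    · simp only [hij, if_false]
      ring
  have h7 : y ⬝ᵥ (G *ᵥ y) = S' * ∑ i, y i ^ 2
      - ∑ i : Fin k, ∑ j : Fin k, c ((j : ℕ) - (i : ℕ)) * (y i * y j) := by
    simp only [dotProduct, mulVec, Finset.mul_sum, h6, Finset.sum_add_distrib,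
      Finset.sum_ite_eq, Finset.mem_univ, if_true, Finset.sum_neg_distrib]
    ring
  rw [h7, ← h3, ← h4]
  rw [h2] at h1
  linarith

/-- At a nondegenerate maximum with second order expansion given by `A`, the linear term vanishes
and the quadratic form is positive definite. -/
lemma posDef_of_isMax {F : (Fin k → ℝ) → ℝ} {L : (Fin k → ℝ) →L[ℝ] ℝ}
    {A : Matrix (Fin k) (Fin k) ℝ} (hsymm : A.IsHermitian) (hdet : A.det ≠ 0)
    (hmax : ∀ y, F y ≤ F 0)
    (hF : (fun y => F y - F 0 - L y + 1 / 2 * (y ⬝ᵥ (A *ᵥ y))) =o[𝓝 0] fun y => ‖y‖ ^ 2) :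
    A.PosDef ∧ (fun y => F 0 - F y - 1 / 2 * (y ⬝ᵥ (A *ᵥ y))) =o[𝓝 0] fun y => ‖y‖ ^ 2 := by
  have hquad : ∃ C, ∀ y : Fin k → ℝ, |y ⬝ᵥ (A *ᵥ y)| ≤ C * ‖y‖ ^ 2 := by
    refine ⟨∑ i, ∑ j, |A i j|, fun y => ?_⟩
    simp only [dotProduct, mulVec, Finset.mul_sum, Finset.sum_mul]
    refine (Finset.abs_sum_le_sum_abs _ _).trans (Finset.sum_le_sum fun i _ => ?_)
    refine (Finset.abs_sum_le_sum_abs _ _).trans (Finset.sum_le_sum fun j _ => ?_)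
    rw [abs_mul, abs_mul]
    have h1 : |y i| ≤ ‖y‖ := norm_le_pi_norm y i
    have h2 : |y j| ≤ ‖y‖ := norm_le_pi_norm y j
    calc |y i| * (|A i j| * |y j|) = |A i j| * (|y i| * |y j|) := by ring
      _ ≤ |A i j| * (‖y‖ * ‖y‖) := by gcongr
      _ = _ := by ring
  obtain ⟨C, hC⟩ := hquad
  have hsq : (fun y : Fin k → ℝ => ‖y‖ ^ 2) =o[𝓝 0] fun y => y := by
    have h1 : (fun y : Fin k → ℝ => ‖y‖) =o[𝓝 0] fun _ => (1 : ℝ) := by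
      rw [Asymptotics.isLittleO_one_iff]
      simpa using (continuous_norm (E := Fin k → ℝ)).tendsto 0
    have h2 := h1.mul_isBigO (Asymptotics.isBigO_refl (fun y : Fin k → ℝ => ‖y‖) (𝓝 0))
    simp only [one_mul] at h2
    refine (h2.norm_right.trans_isBigO ?_).congr_left fun y => by ring
    exact ((Asymptotics.isBigO_refl (fun y : Fin k → ℝ => y) (𝓝 0)).norm_left).norm_left
  -- The quadratic term is o(‖y‖), so L is the derivative of F at a maximum.
  have hL : L = 0 := by
    refine IsLocalMax.hasFDerivAt_eq_zero (f := F) (a := 0) (Eventually.of_forall hmax) ?_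
    rw [hasFDerivAt_iff_isLittleO_nhds_zero]
    have h1 : (fun y : Fin k → ℝ => 1 / 2 * (y ⬝ᵥ (A *ᵥ y))) =o[𝓝 0] fun y => y := by
      refine Asymptotics.IsBigO.trans_isLittleO (g := fun y : Fin k → ℝ => ‖y‖ ^ 2) ?_ hsq
      refine Asymptotics.IsBigO.of_bound C (Eventually.of_forall fun y => ?_)
      have := hC y
      rw [norm_mul, Real.norm_eq_abs, Real.norm_eq_abs, norm_pow, norm_norm]
      rw [abs_of_pos (by norm_num : (0 : ℝ) < 1 / 2)]
      nlinarith [abs_nonneg (y ⬝ᵥ (A *ᵥ y))]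
    refine ((hF.trans hsq).sub h1).congr_left fun y => by simp
  have hexp : (fun y => F 0 - F y - 1 / 2 * (y ⬝ᵥ (A *ᵥ y))) =o[𝓝 0]
      fun y => ‖y‖ ^ 2 := by
    refine hF.neg_left.congr_left fun y => ?_
    simp only [hL, _root_.zero_apply]
    ring
  refine ⟨?_, hexp⟩
  have hpsd : A.PosSemidef := by
    refine PosSemidef.of_dotProduct_mulVec_nonneg hsymm fun y => ?_
    simp only [star_trivial]
    by_contra hneg
    push Not at hneg
    have hy : y ≠ 0 := by rintro rfl; simp at hneg
    set q := y ⬝ᵥ (A *ᵥ y) with hq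
    have hlim : Tendsto (fun r : ℝ => r • y) (𝓝[>] 0) (𝓝 0) := by
      have : Continuous fun r : ℝ => r • y := by fun_prop
      simpa using (this.tendsto 0).mono_left nhdsWithin_le_nhds
    have hyn : 0 < ‖y‖ := norm_pos_iff.2 hy
    -- With this constant the error along r • y is at most -q r²/4, half of the increase -q r²/2
    -- that a negative q would produce.
    have hc : 0 < -q / (4 * ‖y‖ ^ 2) := by
      apply div_pos (by linarith) (by positivity)
    have h1 := hlim.eventually (hexp.def hc)
    obtain ⟨r, hr, hr0⟩ := (h1.and self_mem_nhdsWithin).exists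
    have hr0' : (0 : ℝ) < r := hr0
    have h2 := hmax (r • y)
    rw [mulVec_smul, dotProduct_smul, smul_dotProduct, ← hq, norm_pow, norm_norm, norm_smul,
      Real.norm_eq_abs, Real.norm_eq_abs, abs_of_pos hr0', smul_eq_mul, smul_eq_mul] at hr
    have h3 := (abs_le.1 hr).2
    have h4 : -q / (4 * ‖y‖ ^ 2) * (r * ‖y‖) ^ 2 = -q / 4 * r ^ 2 := by
      field_simp
    rw [h4] at h3
    have h5 : 0 < -q * r ^ 2 := mul_pos (by linarith) (by positivity)
    nlinarith
  exact hpsd.posDef_iff_isUnit.2 ((Matrix.isUnit_iff_isUnit_det _).2 (isUnit_iff_ne_zero.2 hdet))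

/-- The minimum over the compact unit sphere is positive, and homogeneity does the rest. For k = 0
the sphere is empty. -/
lemma exists_pos_mul_sq_le {A : Matrix (Fin k) (Fin k) ℝ} (hA : A.PosDef) :
    ∃ c > 0, ∀ y : Fin k → ℝ, c * ‖y‖ ^ 2 ≤ y ⬝ᵥ (A *ᵥ y) := by
  rcases Nat.eq_zero_or_pos k with rfl | hk
  · exact ⟨1, one_pos, fun y => by simp [Subsingleton.elim y 0]⟩
  have : Nonempty (Fin k) := ⟨⟨0, hk⟩⟩
  have hcont : Continuous fun y : Fin k → ℝ => y ⬝ᵥ (A *ᵥ y) := by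
    simp only [dotProduct, mulVec]
    fun_prop
  obtain ⟨y₀, hy₀, hmin⟩ := (isCompact_sphere (0 : Fin k → ℝ) 1).exists_isMinOn
    (NormedSpace.sphere_nonempty.2 zero_le_one) hcont.continuousOn
  have hy₀' : y₀ ≠ 0 := by
    rintro rfl
    simp at hy₀
  refine ⟨y₀ ⬝ᵥ (A *ᵥ y₀), by simpa using hA.dotProduct_mulVec_pos hy₀', fun y => ?_⟩
  by_cases hy : y = 0
  · simp [hy]
  have hyn : 0 < ‖y‖ := norm_pos_iff.2 hy
  have h1 : ‖y‖⁻¹ • y ∈ Metric.sphere (0 : Fin k → ℝ) 1 := by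
    simp [norm_smul, hyn.ne']
  have h2 := hmin h1
  simp only [Set.mem_ofPred_eq] at h2
  rw [mulVec_smul, dotProduct_smul, smul_dotProduct, smul_eq_mul, smul_eq_mul] at h2
  calc _ ≤ ‖y‖⁻¹ * (‖y‖⁻¹ * (y ⬝ᵥ (A *ᵥ y))) * ‖y‖ ^ 2 := by gcongr
    _ = _ := by field_simp

end Hessian

/-! ### Ellipsoids and Laplace asymptotics -/

section Laplace

open Matrix
open scoped MatrixOrder

variable {k : ℕ}

/-- The positive square root of A turns the ellipsoid into a linear preimage of a Euclidean ball. -/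
lemma exists_sqrt_of_posDef {A : Matrix (Fin k) (Fin k) ℝ} (hA : A.PosDef) :
    ∃ B : Matrix (Fin k) (Fin k) ℝ, B.det = Real.sqrt A.det ∧
      ∀ y, y ⬝ᵥ (A *ᵥ y) = ‖WithLp.toLp 2 (B *ᵥ y)‖ ^ 2 := by
  have hA0 : 0 ≤ A := Matrix.nonneg_iff_posSemidef.2 hA.posSemidef
  refine ⟨CFC.sqrt A, by simpa using hA.posSemidef.det_sqrt, fun y => ?_⟩
  have h1 : CFC.sqrt A * CFC.sqrt A = A := CFC.sqrt_mul_sqrt_self A hA0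
  have h2 : (CFC.sqrt A).IsHermitian :=
    (Matrix.nonneg_iff_posSemidef.1 (CFC.sqrt_nonneg A)).isHermitian
  have h3 : (CFC.sqrt A)ᵀ = CFC.sqrt A := by
    rw [← conjTranspose_eq_transpose_of_trivial]
    exact h2.eq
  conv_lhs => rw [← h1]
  rw [EuclideanSpace.real_norm_sq_eq, ← mulVec_mulVec, dotProduct_mulVec, ← mulVec_transpose, h3]
  simp [dotProduct, sq]

/-- The volume of the inverse image of a set under an invertible linear map into Euclidean
space. -/
lemma volume_preimage_toLp_mulVec {B : Matrix (Fin k) (Fin k) ℝ} (hB : B.det ≠ 0)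
    {E : Set (EuclideanSpace ℝ (Fin k))} (hE : MeasurableSet E) :
    volume {y : Fin k → ℝ | WithLp.toLp 2 (B *ᵥ y) ∈ E}
      = ENNReal.ofReal |B.det⁻¹| * volume E := by
  have h1 : {y : Fin k → ℝ | WithLp.toLp 2 (B *ᵥ y) ∈ E}
      = (Matrix.toLin' B) ⁻¹' ((WithLp.toLp 2) ⁻¹' E) := by
    ext y
    simp
  rw [h1, Measure.addHaar_preimage_linearMap _ (by simpa using hB), LinearMap.det_toLin',
    (PiLp.volume_preserving_toLp (Fin k)).measure_preimage hE.nullMeasurableSet]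

/-- The volume of an ellipsoid. -/
lemma volume_ellipsoid (hk : 0 < k) {A : Matrix (Fin k) (Fin k) ℝ} (hA : A.PosDef) :
    volume.real {y : Fin k → ℝ | 1 / 2 * (y ⬝ᵥ (A *ᵥ y)) ≤ 1}
      = (2 * Real.pi) ^ ((k : ℝ) / 2) / (Real.sqrt A.det * Real.Gamma ((k : ℝ) / 2 + 1)) := by
  have : Nonempty (Fin k) := ⟨⟨0, hk⟩⟩
  obtain ⟨B, hBdet, hB⟩ := exists_sqrt_of_posDef hA
  have hs : 0 < Real.sqrt A.det := Real.sqrt_pos.2 hA.det_pos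
  have h1 : {y : Fin k → ℝ | 1 / 2 * (y ⬝ᵥ (A *ᵥ y)) ≤ 1}
      = {y : Fin k → ℝ | WithLp.toLp 2 (B *ᵥ y) ∈ Metric.closedBall
        (0 : EuclideanSpace ℝ (Fin k)) (Real.sqrt 2)} := by
    ext y
    simp only [Set.mem_ofPred_eq, hB, mem_closedBall_zero_iff]
    rw [Real.le_sqrt (norm_nonneg _) (by norm_num)]
    constructor <;> intro h <;> linarith
  rw [Measure.real, h1, volume_preimage_toLp_mulVec (by rw [hBdet]; exact hs.ne')
    Metric.isClosed_closedBall.measurableSet, EuclideanSpace.volume_closedBall, Fintype.card_fin,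
    hBdet, ENNReal.toReal_mul, ENNReal.toReal_mul, ENNReal.toReal_pow,
    ENNReal.toReal_ofReal (abs_nonneg _), ENNReal.toReal_ofReal (Real.sqrt_nonneg _),
    ENNReal.toReal_ofReal, abs_of_pos (inv_pos.2 hs)]
  · have h2 : (2 * Real.pi) ^ ((k : ℝ) / 2) = Real.sqrt 2 ^ k * Real.sqrt Real.pi ^ k := by
      rw [← mul_pow, ← Real.sqrt_mul (by norm_num), Real.sqrt_eq_rpow, ← Real.rpow_natCast,
        ← Real.rpow_mul (by positivity)]
      congr 1
      ring
    rw [h2]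
    field_simp
  · have : 0 < Real.Gamma ((k : ℝ) / 2 + 1) := Real.Gamma_pos_of_pos (by positivity)
    positivity

/-- The boundary of the ellipsoid is a linear preimage of a sphere, hence null. Off it the
indicators of the rescaled sublevel sets converge. -/
lemma ae_quadratic_ne_one (hk : 0 < k) {A : Matrix (Fin k) (Fin k) ℝ} (hA : A.PosDef) :
    ∀ᵐ y : Fin k → ℝ, 1 / 2 * (y ⬝ᵥ (A *ᵥ y)) ≠ 1 := by
  have : Nonempty (Fin k) := ⟨⟨0, hk⟩⟩
  obtain ⟨B, hBdet, hB⟩ := exists_sqrt_of_posDef hA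
  have hs : 0 < Real.sqrt A.det := Real.sqrt_pos.2 hA.det_pos
  have h1 : {y : Fin k → ℝ | ¬ (1 / 2 * (y ⬝ᵥ (A *ᵥ y)) ≠ 1)}
      ⊆ {y : Fin k → ℝ | WithLp.toLp 2 (B *ᵥ y) ∈ Metric.sphere
        (0 : EuclideanSpace ℝ (Fin k)) (Real.sqrt 2)} := by
    intro y hy
    simp only [Set.mem_ofPred_eq, hB, not_not] at hy
    simp only [Set.mem_ofPred_eq, mem_sphere_zero_iff_norm]
    rw [eq_comm, Real.sqrt_eq_iff_eq_sq (by norm_num) (norm_nonneg _)]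
    linarith
  rw [ae_iff]
  refine measure_mono_null h1 ?_
  rw [volume_preimage_toLp_mulVec (by rw [hBdet]; exact hs.ne')
    Metric.isClosed_sphere.measurableSet, Measure.addHaar_sphere, mul_zero]

lemma measurableSet_quadratic_le (A : Matrix (Fin k) (Fin k) ℝ) :
    MeasurableSet {y : Fin k → ℝ | 1 / 2 * (y ⬝ᵥ (A *ᵥ y)) ≤ 1} := by
  refine measurableSet_le ?_ measurable_const
  simp only [dotProduct, mulVec]
  fun_prop

/-- Laplace asymptotics near a nondegenerate minimum. -/
lemma tendsto_integral_ball_sublevel (hk : 0 < k) {A : Matrix (Fin k) (Fin k) ℝ}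
    (hA : A.PosDef) {Φ ψ : (Fin k → ℝ) → ℝ} (hΦ : Continuous Φ) (hψ : Continuous ψ)
    {P : Fin k → ℝ}
    (hexp : (fun y => ψ (P + y) - 1 / 2 * (y ⬝ᵥ (A *ᵥ y))) =o[𝓝 0] fun y => ‖y‖ ^ 2)
    {c ρ : ℝ} (hc : 0 < c) (hρ : 0 < ρ)
    (hlow : ∀ y, ‖y‖ < ρ → c * ‖y‖ ^ 2 ≤ ψ (P + y)) :
    Tendsto (fun r : ℝ => (r ^ k)⁻¹ * ∫ y in Metric.ball P ρ,
        {y | ψ y ≤ r ^ 2}.indicator Φ y) (𝓝[>] 0)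
      (𝓝 (Φ P * volume.real {y : Fin k → ℝ | 1 / 2 * (y ⬝ᵥ (A *ᵥ y)) ≤ 1})) := by
  set f : ℝ → (Fin k → ℝ) → ℝ := fun r y =>
    (Metric.ball P ρ).indicator ({y | ψ y ≤ r ^ 2}.indicator Φ) y with hf
  have hball : MeasurableSet (Metric.ball P ρ) := Metric.isOpen_ball.measurableSet
  have hsub : ∀ r : ℝ, MeasurableSet {y | ψ y ≤ r ^ 2} := fun r =>
    measurableSet_le hψ.measurable measurable_const
  have hfm : ∀ r, Measurable (f r) := fun r =>
    (hΦ.measurable.indicator (hsub r)).indicator hball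
  -- The substitution y = P + r z produces the factor r ^ k.
  have hscale : ∀ r : ℝ, 0 < r → (r ^ k)⁻¹ * ∫ y in Metric.ball P ρ,
      {y | ψ y ≤ r ^ 2}.indicator Φ y = ∫ z, f r (P + r • z) := by
    intro r hr
    rw [Measure.integral_comp_smul volume (fun y => f r (P + y)) r,
      integral_add_left_eq_self (f r) P, Module.finrank_fin_fun, abs_of_pos (by positivity),
      smul_eq_mul, ← integral_indicator hball]
  obtain ⟨C, hC⟩ := (isCompact_closedBall P ρ).exists_bound_of_continuousOn hΦ.continuousOn
  have hC0 : 0 ≤ C := (norm_nonneg _).trans (hC P (Metric.mem_closedBall_self hρ.le))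
  have hlim : Tendsto (fun r : ℝ => ∫ z, f r (P + r • z)) (𝓝[>] 0)
      (𝓝 (∫ z, {y : Fin k → ℝ | 1 / 2 * (y ⬝ᵥ (A *ᵥ y)) ≤ 1}.indicator (fun _ => Φ P) z)) := by
    -- On the support c r²‖z‖² ≤ ψ(P + r z) ≤ r², so z stays in the fixed ball of radius c^{-1/2},
    -- and Φ is bounded on the closed ball around P.
    refine tendsto_integral_filter_of_dominated_convergence
      ((Metric.closedBall (0 : Fin k → ℝ) (Real.sqrt c⁻¹)).indicator fun _ => C) ?_ ?_ ?_ ?_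
    · refine Eventually.of_forall fun r => ?_
      have : Measurable fun z : Fin k → ℝ => P + r • z := by fun_prop
      exact ((hfm r).comp this).aestronglyMeasurable
    · filter_upwards [self_mem_nhdsWithin] with r hr
      have hr' : (0 : ℝ) < r := hr
      refine ae_of_all _ fun z => ?_
      simp only [hf]
      by_cases h1 : P + r • z ∈ Metric.ball P ρ
      · rw [Set.indicator_of_mem h1]
        by_cases h2 : P + r • z ∈ {y | ψ y ≤ r ^ 2}
        · rw [Set.indicator_of_mem h2]
          have h3 : ‖r • z‖ < ρ := by simpa using h1
          have h4 := (hlow _ h3).trans h2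
          rw [norm_smul, Real.norm_eq_abs, abs_of_pos hr'] at h4
          have h5 : z ∈ Metric.closedBall (0 : Fin k → ℝ) (Real.sqrt c⁻¹) := by
            rw [mem_closedBall_zero_iff, Real.le_sqrt (norm_nonneg _) (by positivity)]
            have h6 : c * ‖z‖ ^ 2 ≤ 1 := by
              have : r ^ 2 * (c * ‖z‖ ^ 2) ≤ r ^ 2 * 1 := by linarith
              exact le_of_mul_le_mul_left this (by positivity)
            rw [inv_eq_one_div, le_div_iff₀ hc]
            linarith
          rw [Set.indicator_of_mem h5]
          exact hC _ (Metric.ball_subset_closedBall h1)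
        · rw [Set.indicator_of_notMem h2, norm_zero]
          exact Set.indicator_nonneg (fun _ _ => hC0) _
      · rw [Set.indicator_of_notMem h1, norm_zero]
        exact Set.indicator_nonneg (fun _ _ => hC0) _
    · refine (integrable_indicator_iff Metric.isClosed_closedBall.measurableSet).2 ?_
      exact integrableOn_const (measure_closedBall_lt_top).ne
    · filter_upwards [ae_quadratic_ne_one hk hA] with z hz
      have hr0 : Tendsto (fun r : ℝ => r • z) (𝓝[>] 0) (𝓝 0) := by
        have : Continuous fun r : ℝ => r • z := by fun_prop
        simpa using (this.tendsto 0).mono_left nhdsWithin_le_nhds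
      have hP : Tendsto (fun r : ℝ => P + r • z) (𝓝[>] 0) (𝓝 P) := by
        simpa using hr0.const_add P
      have hin : ∀ᶠ r : ℝ in 𝓝[>] 0, P + r • z ∈ Metric.ball P ρ :=
        hP.eventually (Metric.ball_mem_nhds P hρ)
      -- The sublevel condition is that this quotient is at most 1; as its limit differs from 1, the
      -- indicator is eventually constant.
      have hquot : Tendsto (fun r : ℝ => ψ (P + r • z) / r ^ 2) (𝓝[>] 0)
          (𝓝 (1 / 2 * (z ⬝ᵥ (A *ᵥ z)))) := by
        have h1 := hexp.comp_tendsto hr0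
        have h2 : (fun r : ℝ => ψ (P + r • z) - r ^ 2 * (1 / 2 * (z ⬝ᵥ (A *ᵥ z))))
            =o[𝓝[>] 0] fun r : ℝ => r ^ 2 := by
          refine (h1.congr_left (f₂ := fun r : ℝ => ψ (P + r • z)
            - r ^ 2 * (1 / 2 * (z ⬝ᵥ (A *ᵥ z)))) fun r => ?_).trans_isBigO ?_
          · simp only [Function.comp_apply, mulVec_smul, dotProduct_smul, smul_dotProduct,
              smul_eq_mul]
            ring
          · refine Asymptotics.IsBigO.of_bound (‖z‖ ^ 2) (Eventually.of_forall fun r => ?_)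
            simp only [Function.comp_apply, norm_smul, norm_pow, norm_mul, norm_norm]
            exact le_of_eq (by ring)
        have h3 := h2.tendsto_div_nhds_zero
        have h4 := h3.add_const (1 / 2 * (z ⬝ᵥ (A *ᵥ z)))
        rw [zero_add] at h4
        refine h4.congr' ?_
        filter_upwards [self_mem_nhdsWithin] with r hr
        have hr' : (0 : ℝ) < r := hr
        field_simp
        ring
      rcases lt_or_gt_of_ne hz with hz1 | hz1
      · rw [Set.indicator_of_mem (by exact hz1.le)]
        refine ((hΦ.tendsto P).comp hP).congr' ?_
        filter_upwards [hin, hquot.eventually_lt_const hz1, self_mem_nhdsWithin] with r h1 h2 hr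
        have hr' : (0 : ℝ) < r := hr
        rw [div_lt_one (by positivity)] at h2
        simp only [hf]
        rw [Set.indicator_of_mem h1, Set.indicator_of_mem (by exact h2.le), Function.comp_apply]
      · rw [Set.indicator_of_notMem (by simpa using hz1)]
        refine tendsto_const_nhds.congr' ?_
        filter_upwards [hin, hquot.eventually_const_lt hz1, self_mem_nhdsWithin] with r h1 h2 hr
        have hr' : (0 : ℝ) < r := hr
        rw [one_lt_div (by positivity)] at h2
        simp only [hf]
        rw [Set.indicator_of_mem h1, Set.indicator_of_notMem (by simpa using h2)]
  rw [integral_indicator_const _ (measurableSet_quadratic_le A), smul_eq_mul, mul_comm] at hlim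
  refine hlim.congr' ?_
  filter_upwards [self_mem_nhdsWithin] with r hr
  exact (hscale r hr).symm

end Laplace

/-! ### Nearly maximal tuples are nearly regular -/

section Maximizers

variable {k : ℕ} {h : ℝ → ℝ}

/-- The polar angles of the vertices of the regular polygon that starts at angle `0`, except the
first one. -/
def regularTail (k : ℕ) (i : Fin k) : ℝ := 2 * Real.pi * ((i : ℕ) + 1) / (k + 1 : ℕ)

lemma consZero_regularTail : consZero (regularTail k) = regularAngles (k + 1) := by
  ext i
  refine Fin.cases ?_ (fun i => ?_) i
  · simp [regularAngles]
  · simp [regularAngles, regularTail]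

lemma pairSum_consZero_comp_perm (heven : ∀ x, h (-x) = h x) (y : Fin k → ℝ)
    (τ : Equiv.Perm (Fin k)) :
    pairSum h (consZero fun i => y (τ i)) = pairSum h (consZero y) := by
  rw [← pairSum_comp_perm heven (consZero y) (Equiv.Perm.decomposeFin.symm (0, τ))]
  congr 1
  ext i
  refine Fin.cases ?_ (fun i => ?_) i
  · simp
  · simp [Equiv.Perm.decomposeFin_symm_apply_succ]

/-- The maximizers of `pairSum h` are the tuples of polar angles of the vertices of a regular
polygon. -/
def OnlyRegularMax (k : ℕ) (h : ℝ → ℝ) : Prop :=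
  ∀ θ : Fin (k + 1) → ℝ, (∀ θ' : Fin (k + 1) → ℝ, pairSum h θ' ≤ pairSum h θ) →
    ∃ (w : ℝ) (σ : Equiv.Perm (Fin (k + 1))), ∀ i, ∃ n : ℤ,
      θ (σ i) = regularAngles (k + 1) i + w + n * (2 * Real.pi)

/-- `OnlyRegularMax` does not say that regular polygons are maximizers. A maximizer exists by
periodicity and compactness; it is regular, and all regular polygons have the same pair sum. -/
lemma pairSum_le_regularAngles (hc : Continuous h) (heven : ∀ x, h (-x) = h x)
    (hper : Function.Periodic h (2 * Real.pi)) (hmax : OnlyRegularMax k h)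
    (θ : Fin (k + 1) → ℝ) : pairSum h θ ≤ pairSum h (regularAngles (k + 1)) := by
  have hcomp : IsCompact (Set.univ.pi fun _ : Fin (k + 1) => Set.Icc 0 (2 * Real.pi)) :=
    isCompact_univ_pi fun _ => isCompact_Icc
  obtain ⟨θ₀, -, hθ₀⟩ := hcomp.exists_isMaxOn
    ⟨fun _ => 0, fun _ _ => ⟨le_rfl, Real.two_pi_pos.le⟩⟩
    (continuous_pairSum (m := k + 1) hc).continuousOn
  have hall : ∀ θ' : Fin (k + 1) → ℝ, pairSum h θ' ≤ pairSum h θ₀ := by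
    intro θ'
    have h1 : pairSum h (fun i => toIcoMod Real.two_pi_pos 0 (θ' i)) = pairSum h θ' := by
      refine pairSum_congr_of_periodic hper fun i => ⟨-toIcoDiv Real.two_pi_pos 0 (θ' i), ?_⟩
      rw [← self_sub_toIcoDiv_zsmul, zsmul_eq_mul]
      push_cast
      ring
    rw [← h1]
    refine hθ₀ fun i _ => ?_
    have := toIcoMod_mem_Ico Real.two_pi_pos 0 (θ' i)
    rw [zero_add] at this
    exact ⟨this.1, this.2.le⟩
  obtain ⟨w, σ, hσ⟩ := hmax θ₀ hall
  have h2 : pairSum h θ₀ = pairSum h (regularAngles (k + 1)) := by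
    rw [← pairSum_comp_perm heven θ₀ σ, ← pairSum_add_const (regularAngles (k + 1)) w]
    exact pairSum_congr_of_periodic hper hσ
  rw [← h2]
  exact hall θ

/-- With one vertex at angle 0 the others are at 2πl/(k+1) for integers l that are nonzero and
distinct modulo k + 1. As 0 ≤ l ≤ k + 1, they exhaust 1, …, k. -/
lemma exists_perm_of_pairSum_eq (hc : Continuous h) (heven : ∀ x, h (-x) = h x)
    (hper : Function.Periodic h (2 * Real.pi)) (hmax : OnlyRegularMax k h)
    {y : Fin k → ℝ} (hy : ∀ i, y i ∈ Set.Icc 0 (2 * Real.pi))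
    (heq : pairSum h (regularAngles (k + 1)) ≤ pairSum h (consZero y)) :
    ∃ τ : Equiv.Perm (Fin k), y = fun i => regularTail k (τ i) := by
  obtain ⟨w, σ, hσ⟩ := hmax (consZero y) fun θ' =>
    (pairSum_le_regularAngles hc heven hper hmax θ').trans heq
  choose n hn using hσ
  have hpi := Real.pi_pos
  have hk : (0 : ℝ) < (k + 1 : ℕ) := by positivity
  set a := σ.symm 0 with ha
  have h0 := hn a
  rw [ha, Equiv.apply_symm_apply, consZero_zero] at h0
  -- Subtracting the equation for the vertex a, the one at angle 0, eliminates the rotation w.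
  set l : Fin k → ℤ := fun j => ((σ.symm j.succ : Fin (k + 1)) : ℕ) - ((a : Fin (k + 1)) : ℕ)
    + (k + 1 : ℕ) * (n (σ.symm j.succ) - n a) with hl
  have hyl : ∀ j, y j = 2 * Real.pi * l j / (k + 1 : ℕ) := by
    intro j
    have h1 := hn (σ.symm j.succ)
    rw [Equiv.apply_symm_apply, consZero_succ] at h1
    simp only [hl, regularAngles, ← ha] at h0 h1 ⊢
    push_cast at h0 h1 hk ⊢
    rw [h1]
    field_simp
    field_simp at h0
    linarith
  have hlb : ∀ j, 0 ≤ l j ∧ l j ≤ (k + 1 : ℕ) := by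
    intro j
    have h1 := (hy j).1
    have h2 := (hy j).2
    rw [hyl] at h1 h2
    constructor
    · by_contra hneg
      push Not at hneg
      have h3 : (l j : ℝ) < 0 := by exact_mod_cast hneg
      have : 2 * Real.pi * l j / (k + 1 : ℕ) < 0 := div_neg_of_neg_of_pos (by nlinarith) hk
      linarith
    · rw [div_le_iff₀ hk] at h2
      have h3 : (l j : ℝ) ≤ ((k + 1 : ℕ) : ℝ) := by nlinarith
      exact_mod_cast h3
  have hmod : ∀ j, ∀ q : ℤ, l j = (k + 1 : ℕ) * q → False := by
    intro j q hq
    have h1 : (((σ.symm j.succ : Fin (k + 1)) : ℕ) : ℤ) - ((a : Fin (k + 1)) : ℕ)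
        = (k + 1 : ℕ) * (q - (n (σ.symm j.succ) - n a)) := by
      rw [mul_sub, ← hq]; simp only [hl]; ring
    have h2 := (σ.symm j.succ).2
    have h3 := a.2
    have h4 : q - (n (σ.symm j.succ) - n a) = 0 := by
      by_contra hne
      rcases lt_or_gt_of_ne hne with h5 | h5 <;> push_cast at h1 <;> nlinarith
    rw [h4, mul_zero, sub_eq_zero] at h1
    have h5 : σ.symm j.succ = a := Fin.ext (by exact_mod_cast h1)
    rw [ha] at h5
    exact Fin.succ_ne_zero j (σ.symm.injective h5)
  have hlb' : ∀ j, 1 ≤ l j ∧ l j ≤ k := by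
    intro j
    obtain ⟨h1, h2⟩ := hlb j
    have h3 : l j ≠ 0 := fun h => hmod j 0 (by simpa using h)
    have h4 : l j ≠ (k + 1 : ℕ) := fun h => hmod j 1 (by simpa using h)
    push_cast at h2 h4
    omega
  set f : Fin k → Fin k := fun j => ⟨(l j - 1).toNat, by have := hlb' j; omega⟩ with hf
  have hfl : ∀ j, ((f j : ℕ) : ℤ) = l j - 1 := fun j => by
    have := hlb' j
    simp only [hf]
    omega
  have hinj : Function.Injective f := by
    intro i j hij
    have h1 : l i = l j := by
      have h2 := hfl i
      have h3 := hfl j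
      rw [hij] at h2
      omega
    have h1' : (((σ.symm i.succ : Fin (k + 1)) : ℕ) : ℤ) - ((σ.symm j.succ : Fin (k + 1)) : ℕ)
        = (k + 1 : ℕ) * (n (σ.symm j.succ) - n (σ.symm i.succ)) := by
      simp only [hl] at h1
      linarith
    have h2 := (σ.symm i.succ).2
    have h3 := (σ.symm j.succ).2
    have h4 : n (σ.symm j.succ) - n (σ.symm i.succ) = 0 := by
      by_contra hne
      rcases lt_or_gt_of_ne hne with h5 | h5 <;> push_cast at h1' <;> nlinarith
    rw [h4, mul_zero, sub_eq_zero] at h1'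
    have h5 : σ.symm i.succ = σ.symm j.succ := Fin.ext (by exact_mod_cast h1')
    exact Fin.succ_injective _ (σ.symm.injective h5)
  refine ⟨Equiv.ofBijective f (Finite.injective_iff_bijective.1 hinj), ?_⟩
  ext j
  have h1 : (((f j : ℕ) : ℤ) : ℝ) = ((l j - 1 : ℤ) : ℝ) := by rw [hfl]
  rw [hyl]
  simp only [Equiv.ofBijective_apply, regularTail]
  push_cast at h1
  rw [h1]
  ring

/-- Outside the balls around the permuted polygons the cube is compact, and the pair sum has a
maximum there strictly below the global one. -/
lemma exists_near_perm (hc : Continuous h) (heven : ∀ x, h (-x) = h x)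
    (hper : Function.Periodic h (2 * Real.pi)) (hmax : OnlyRegularMax k h)
    {ρ : ℝ} (hρ : 0 < ρ) :
    ∃ ε > 0, ∀ y : Fin k → ℝ, (∀ i, y i ∈ Set.Icc 0 (2 * Real.pi)) →
      pairSum h (regularAngles (k + 1)) - ε < pairSum h (consZero y) →
        ∃ τ : Equiv.Perm (Fin k), ‖y - fun i => regularTail k (τ i)‖ < ρ := by
  set K : Set (Fin k → ℝ) := (Set.univ.pi fun _ => Set.Icc 0 (2 * Real.pi))
    \ ⋃ τ : Equiv.Perm (Fin k), Metric.ball (fun i => regularTail k (τ i)) ρ with hK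
  have hKc : IsCompact K := (isCompact_univ_pi fun _ => isCompact_Icc).diff
    (isOpen_iUnion fun τ => Metric.isOpen_ball)
  have hcont : Continuous fun y : Fin k → ℝ => pairSum h (consZero y) :=
    (continuous_pairSum hc).comp continuous_consZero
  have hmem : ∀ y : Fin k → ℝ, (∀ i, y i ∈ Set.Icc 0 (2 * Real.pi)) →
      (¬ ∃ τ : Equiv.Perm (Fin k), ‖y - fun i => regularTail k (τ i)‖ < ρ) → y ∈ K := by
    intro y hy hn
    refine ⟨fun i _ => hy i, fun hy' => hn ?_⟩
    obtain ⟨τ, hτ⟩ := Set.mem_iUnion.1 hy'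
    exact ⟨τ, by simpa [dist_eq_norm] using hτ⟩
  rcases K.eq_empty_or_nonempty with hKe | hKn
  · refine ⟨1, one_pos, fun y hy _ => ?_⟩
    by_contra hn
    have := hmem y hy hn
    rw [hKe] at this
    exact this
  · obtain ⟨y₀, hy₀, hy₀max⟩ := hKc.exists_isMaxOn hKn hcont.continuousOn
    have hlt : pairSum h (consZero y₀) < pairSum h (regularAngles (k + 1)) := by
      by_contra hge
      push Not at hge
      obtain ⟨τ, hτ⟩ := exists_perm_of_pairSum_eq hc heven hper hmax
        (fun i => hy₀.1 i (Set.mem_univ i)) hge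
      refine hy₀.2 (Set.mem_iUnion.2 ⟨τ, ?_⟩)
      rw [← hτ]
      exact Metric.mem_ball_self hρ
    refine ⟨_, sub_pos.2 hlt, fun y hy hlow => ?_⟩
    by_contra hn
    have : pairSum h (consZero y) ≤ pairSum h (consZero y₀) := hy₀max (hmem y hy hn)
    linarith

/-- Rates of decrease of the pair sum near the regular polygon. -/
structure LocalExpansion (k : ℕ) (h : ℝ → ℝ) (A : Matrix (Fin k) (Fin k) ℝ) : Prop where
  posDef : A.PosDef
  isLittleO : (fun y : Fin k → ℝ => pairSum h (regularAngles (k + 1))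
      - pairSum h (consZero (regularTail k + y)) - 1 / 2 * (y ⬝ᵥ (A.mulVec y)))
      =o[𝓝 0] fun y => ‖y‖ ^ 2

lemma LocalExpansion.exists_lower {A : Matrix (Fin k) (Fin k) ℝ} (hA : LocalExpansion k h A) :
    ∃ c > 0, ∃ ρ > 0, ∀ y : Fin k → ℝ, ‖y‖ < ρ → c * ‖y‖ ^ 2 ≤
      pairSum h (regularAngles (k + 1)) - pairSum h (consZero (regularTail k + y)) := by
  obtain ⟨c, hc, hcA⟩ := exists_pos_mul_sq_le hA.posDef
  -- Half the form is at least c‖y‖²/2; an error of at most c‖y‖²/4 leaves c‖y‖²/4.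
  have h1 := hA.isLittleO.def (show 0 < c / 4 by linarith)
  obtain ⟨ρ, hρ, hball⟩ := Metric.eventually_nhds_iff_ball.1 h1
  refine ⟨c / 4, by linarith, ρ, hρ, fun y hy => ?_⟩
  have h2 := hball y (by simpa using hy)
  rw [Real.norm_eq_abs, norm_pow, norm_norm] at h2
  have h3 := (abs_le.1 h2).1
  have h4 := hcA y
  linarith

lemma norm_comp_perm (z : Fin k → ℝ) (τ : Equiv.Perm (Fin k)) : ‖fun i => z (τ i)‖ = ‖z‖ := by
  refine le_antisymm ((pi_norm_le_iff_of_nonneg (norm_nonneg _)).2 fun i => norm_le_pi_norm z _)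
    ((pi_norm_le_iff_of_nonneg (norm_nonneg _)).2 fun i => ?_)
  simpa using norm_le_pi_norm (fun i => z (τ i)) (τ.symm i)

/-- Tuples with a nearly maximal pair sum are close to a regular polygon. -/
lemma exists_norm_sub_le (hc : Continuous h) (heven : ∀ x, h (-x) = h x)
    (hper : Function.Periodic h (2 * Real.pi)) (hmax : OnlyRegularMax k h)
    {A : Matrix (Fin k) (Fin k) ℝ} (hA : LocalExpansion k h A) :
    ∃ C > 0, ∃ ε > 0, ∀ r, 0 < r → r ^ 2 < ε → ∀ y : Fin k → ℝ,
      (∀ i, y i ∈ Set.Icc 0 (2 * Real.pi)) →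
      pairSum h (regularAngles (k + 1)) - r ^ 2 ≤ pairSum h (consZero y) →
        ∃ τ : Equiv.Perm (Fin k), ‖y - fun i => regularTail k (τ i)‖ ≤ C * r := by
  obtain ⟨c, hc0, ρ, hρ, hlow⟩ := hA.exists_lower
  obtain ⟨ε, hε, hnear⟩ := exists_near_perm hc heven hper hmax hρ
  -- Compactness only gives distance below ρ. Inside that ball c‖z‖² ≤ r², which improves it to
  -- c^{-1/2} r.
  refine ⟨Real.sqrt c⁻¹, by positivity, ε, hε, fun r hr hrε y hy hge => ?_⟩
  obtain ⟨τ, hτ⟩ := hnear y hy (by linarith)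
  refine ⟨τ, ?_⟩
  set z := y - fun i => regularTail k (τ i) with hz
  have hzn : ‖fun i => z (τ.symm i)‖ = ‖z‖ := norm_comp_perm z τ.symm
  have h1 := hlow (fun i => z (τ.symm i)) (by rw [hzn]; exact hτ)
  have h2 : pairSum h (consZero (regularTail k + fun i => z (τ.symm i)))
      = pairSum h (consZero y) := by
    rw [← pairSum_consZero_comp_perm heven y τ.symm]
    congr 2
    ext i
    simp [hz]
  rw [h2, hzn] at h1
  have h3 : c * ‖z‖ ^ 2 ≤ r ^ 2 := by linarith
  refine abs_le_of_sq_le_sq' (a := ‖z‖) ?_ (by positivity) |>.2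
  rw [mul_pow, Real.sq_sqrt (by positivity), inv_mul_eq_div, le_div_iff₀ hc0]
  linarith

/-- In a tuple of angles with a nearly maximal pair sum all differences are close to multiples of
`2π / (k + 1)`. -/
lemma exists_int_abs_sub_le (hc : Continuous h) (heven : ∀ x, h (-x) = h x)
    (hper : Function.Periodic h (2 * Real.pi)) (hmax : OnlyRegularMax k h)
    {A : Matrix (Fin k) (Fin k) ℝ} (hA : LocalExpansion k h A) :
    ∃ C > 0, ∃ ε > 0, ∀ r, 0 < r → r ^ 2 < ε → ∀ θ : Fin (k + 1) → ℝ,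
      (∀ i, θ i ∈ Set.Ico 0 (2 * Real.pi)) →
      pairSum h (regularAngles (k + 1)) - r ^ 2 ≤ pairSum h θ → ∀ i j, i ≠ j →
        ∃ l ∈ Finset.Icc (-(k + 1 : ℕ) : ℤ) (k + 1 : ℕ),
          |θ j - (θ i + 2 * Real.pi * l / (k + 1 : ℕ))| ≤ C * r := by
  obtain ⟨C, hC, ε, hε, hnear⟩ := exists_norm_sub_le hc heven hper hmax hA
  refine ⟨C, hC, ε, hε, fun r hr hrε θ hθ hge i j hij => ?_⟩
  -- The i-th point is made the base point by a swap with index 0 and a rotation.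
  set y : Fin k → ℝ := fun a =>
    toIcoMod Real.two_pi_pos 0 (θ (Equiv.swap 0 i a.succ) - θ i) with hy
  have hymem : ∀ a, y a ∈ Set.Ico 0 (2 * Real.pi) := fun a => by
    simpa using toIcoMod_mem_Ico Real.two_pi_pos 0 (θ (Equiv.swap 0 i a.succ) - θ i)
  have h1 : pairSum h (consZero y) = pairSum h θ := by
    rw [← pairSum_comp_perm heven θ (Equiv.swap 0 i),
      ← pairSum_add_const (fun a => θ (Equiv.swap 0 i a)) (-θ i)]
    refine pairSum_congr_of_periodic hper fun a => ?_
    refine Fin.cases ⟨0, by simp⟩ (fun a => ?_) a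
    refine ⟨-toIcoDiv Real.two_pi_pos 0 (θ (Equiv.swap 0 i a.succ) - θ i), ?_⟩
    simp only [consZero_succ, hy]
    rw [← self_sub_toIcoDiv_zsmul, zsmul_eq_mul]
    push_cast
    ring
  obtain ⟨τ, hτ⟩ := hnear r hr hrε y (fun a => ⟨(hymem a).1, (hymem a).2.le⟩) (by rwa [h1])
  obtain ⟨a, ha⟩ : ∃ a : Fin k, Equiv.swap 0 i a.succ = j := by
    have hne : Equiv.swap 0 i j ≠ 0 := by
      intro h0
      have := congrArg (Equiv.swap 0 i) h0
      rw [Equiv.swap_apply_self, Equiv.swap_apply_left] at this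
      exact hij this.symm
    obtain ⟨a, ha⟩ := Fin.exists_succ_eq.2 hne
    exact ⟨a, by rw [ha, Equiv.swap_apply_self]⟩
  have h2 : |y a - regularTail k (τ a)| ≤ C * r :=
    (norm_le_pi_norm (y - fun i => regularTail k (τ i)) a).trans hτ
  have h3 : y a = toIcoMod Real.two_pi_pos 0 (θ j - θ i) := by rw [hy, ← ha]
  have hk : (0 : ℝ) < ((k + 1 : ℕ) : ℝ) := by positivity
  have hτlt := (τ a).2
  by_cases hle : θ i ≤ θ j
  · have h4 : toIcoMod Real.two_pi_pos 0 (θ j - θ i) = θ j - θ i := by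
      rw [toIcoMod_eq_self]
      have := (hθ i).1
      have := (hθ j).2
      constructor <;> linarith
    refine ⟨((τ a : ℕ) : ℤ) + 1, by rw [Finset.mem_Icc]; push_cast; omega, ?_⟩
    rw [h3, h4, regularTail] at h2
    convert h2 using 2
    push_cast
    ring
  · have h4 : toIcoMod Real.two_pi_pos 0 (θ j - θ i) = θ j - θ i + 2 * Real.pi := by
      rw [← toIcoMod_add_right, toIcoMod_eq_self]
      have := (hθ i).2
      have := (hθ j).1
      constructor <;> linarith
    -- Reducing the negative difference into [0, 2π) adds 2π, which lowers l by k + 1.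
    refine ⟨((τ a : ℕ) : ℤ) + 1 - (k + 1 : ℕ), by rw [Finset.mem_Icc]; push_cast; omega, ?_⟩
    rw [h3, h4, regularTail] at h2
    convert h2 using 2
    push_cast
    field_simp
    ring

end Maximizers

/-! ### Summing over the orderings of the polygon -/

section CubeIntegral

variable {k : ℕ} {h : ℝ → ℝ}

/-- This gap from 0 and 2π keeps small balls around the permuted vertices inside the cube; the gap
between vertices in `le_abs_regularTail_sub` keeps those balls disjoint. -/
lemma regularTail_mem (i : Fin k) :
    2 * Real.pi / (k + 1 : ℕ) ≤ regularTail k i ∧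
      regularTail k i ≤ 2 * Real.pi - 2 * Real.pi / (k + 1 : ℕ) := by
  have hk : (0 : ℝ) < ((k + 1 : ℕ) : ℝ) := by positivity
  have hi : ((i : ℕ) : ℝ) + 1 ≤ k := by exact_mod_cast i.2
  have hpi := Real.pi_pos
  rw [regularTail]
  constructor
  · rw [div_le_div_iff_of_pos_right hk]
    nlinarith [Nat.cast_nonneg (α := ℝ) (i : ℕ)]
  · rw [le_sub_iff_add_le, ← add_div, div_le_iff₀ hk]
    push_cast
    nlinarith

lemma le_abs_regularTail_sub {i j : Fin k} (hij : i ≠ j) :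
    2 * Real.pi / (k + 1 : ℕ) ≤ |regularTail k i - regularTail k j| := by
  have hk : (0 : ℝ) < ((k + 1 : ℕ) : ℝ) := by positivity
  have h1 : regularTail k i - regularTail k j
      = 2 * Real.pi / (k + 1 : ℕ) * (((i : ℕ) : ℝ) - (j : ℕ)) := by
    simp only [regularTail]
    ring
  have hc : 0 < 2 * Real.pi / (k + 1 : ℕ) := div_pos Real.two_pi_pos hk
  have h2 : (1 : ℝ) ≤ |((i : ℕ) : ℝ) - (j : ℕ)| := by
    have : (1 : ℤ) ≤ |((i : ℕ) : ℤ) - (j : ℕ)| := by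
      refine Int.one_le_abs (sub_ne_zero.2 fun h => hij (Fin.ext (by exact_mod_cast h)))
    exact_mod_cast this
  rw [h1, abs_mul, abs_of_pos hc]
  exact le_mul_of_one_le_right hc.le h2

lemma measurePreserving_comp_perm (τ : Equiv.Perm (Fin k)) :
    MeasurePreserving (fun (y : Fin k → ℝ) i => y (τ i)) := by
  have h1 := volume_preserving_arrowCongr' (β₁ := ℝ) (β₂ := ℝ) τ.symm (MeasurableEquiv.refl ℝ)
    (MeasurePreserving.id _)
  exact h1

lemma measurableEmbedding_comp_perm (τ : Equiv.Perm (Fin k)) :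
    MeasurableEmbedding (fun (y : Fin k → ℝ) i => y (τ i)) :=
  (MeasurableEquiv.arrowCongr' τ.symm (MeasurableEquiv.refl ℝ)).measurableEmbedding

/-- Asymptotics of the integral of a symmetric function over the set where the pair sum is nearly
maximal. -/
lemma tendsto_setIntegral_cube (hk : 0 < k) (hc : Continuous h) (heven : ∀ x, h (-x) = h x)
    (hper : Function.Periodic h (2 * Real.pi)) (hmax : OnlyRegularMax k h)
    {A : Matrix (Fin k) (Fin k) ℝ} (hA : LocalExpansion k h A)
    {Φ : (Fin k → ℝ) → ℝ} (hΦ : Continuous Φ)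
    (hΦperm : ∀ y (τ : Equiv.Perm (Fin k)), Φ (fun i => y (τ i)) = Φ y) :
    Tendsto (fun r : ℝ => (r ^ k)⁻¹ * ∫ y in Set.univ.pi fun _ : Fin k => Set.Ico 0 (2 * Real.pi),
        {y | pairSum h (regularAngles (k + 1)) - r ^ 2 ≤ pairSum h (consZero y)}.indicator Φ y)
      (𝓝[>] 0) (𝓝 (k.factorial * (Φ (regularTail k)
        * volume.real {y : Fin k → ℝ | 1 / 2 * (y ⬝ᵥ (A.mulVec y)) ≤ 1}))) := by
  obtain ⟨c, hc0, ρ₀, hρ₀, hlow⟩ := hA.exists_lower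
  set M := pairSum h (regularAngles (k + 1)) with hM
  set ψ : (Fin k → ℝ) → ℝ := fun y => M - pairSum h (consZero y) with hψ
  have hψc : Continuous ψ :=
    continuous_const.sub ((continuous_pairSum hc).comp continuous_consZero)
  have hk' : (0 : ℝ) < ((k + 1 : ℕ) : ℝ) := by positivity
  -- The bound π/(k+1) is half the vertex spacing, so the k! balls are disjoint and lie in the cube.
  set ρ := min ρ₀ (Real.pi / (k + 1 : ℕ)) with hρdef
  have hρ : 0 < ρ := lt_min hρ₀ (div_pos Real.pi_pos hk')
  have hρle : 2 * ρ ≤ 2 * Real.pi / (k + 1 : ℕ) := by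
    have := min_le_right ρ₀ (Real.pi / (k + 1 : ℕ))
    rw [mul_div_assoc]
    linarith
  obtain ⟨ε, hε, hnear⟩ := exists_near_perm hc heven hper hmax hρ
  have hlap := tendsto_integral_ball_sublevel hk hA.posDef hΦ hψc hA.isLittleO hc0 hρ
    fun y hy => hlow y (hy.trans_le (min_le_left _ _))
  set B : Equiv.Perm (Fin k) → Set (Fin k → ℝ) := fun τ =>
    Metric.ball (fun i => regularTail k (τ i)) ρ with hB
  have hS : ∀ r : ℝ, {y | M - r ^ 2 ≤ pairSum h (consZero y)} = {y | ψ y ≤ r ^ 2} := by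
    intro r
    ext y
    simp only [hψ, Set.mem_ofPred_eq]
    constructor <;> intro h <;> linarith
  have hSm : ∀ r : ℝ, MeasurableSet {y | ψ y ≤ r ^ 2} := fun r =>
    measurableSet_le hψc.measurable measurable_const
  have hBcube : ∀ τ, B τ ⊆ Set.univ.pi fun _ : Fin k => Set.Ico 0 (2 * Real.pi) := by
    intro τ y hy i _
    have h1 : |y i - regularTail k (τ i)| < ρ := by
      refine (norm_le_pi_norm (y - fun i => regularTail k (τ i)) i).trans_lt ?_
      simpa [hB, dist_eq_norm] using hy
    have h2 := regularTail_mem (τ i)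
    have h3 := abs_lt.1 h1
    constructor <;> linarith
  have hdisj : Pairwise (Function.onFun Disjoint B) := by
    intro τ τ' hne
    obtain ⟨i, hi⟩ : ∃ i, τ i ≠ τ' i := by
      by_contra hcon
      push Not at hcon
      exact hne (Equiv.ext hcon)
    refine Metric.ball_disjoint_ball ?_
    have h1 := le_abs_regularTail_sub hi
    have h2 := dist_le_pi_dist (fun i => regularTail k (τ i)) (fun i => regularTail k (τ' i)) i
    rw [Real.dist_eq] at h2
    linarith
  have hsplit : ∀ r : ℝ, 0 < r → r ^ 2 < ε →
      ∫ y in Set.univ.pi fun _ : Fin k => Set.Ico 0 (2 * Real.pi),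
        {y | ψ y ≤ r ^ 2}.indicator Φ y
      = k.factorial * ∫ y in Metric.ball (regularTail k) ρ, {y | ψ y ≤ r ^ 2}.indicator Φ y := by
    intro r hr hrε
    rw [setIntegral_indicator (hSm r), setIntegral_indicator (hSm r)]
    have e1 : (Set.univ.pi fun _ : Fin k => Set.Ico 0 (2 * Real.pi)) ∩ {y | ψ y ≤ r ^ 2}
        = ⋃ τ, (B τ ∩ {y | ψ y ≤ r ^ 2}) := by
      ext y
      constructor
      · rintro ⟨hy1, hy2⟩
        have hy2' : M - pairSum h (consZero y) ≤ r ^ 2 := hy2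
        obtain ⟨τ, hτ⟩ := hnear y (fun i => Set.Ico_subset_Icc_self (hy1 i (Set.mem_univ i)))
          (by linarith)
        exact Set.mem_iUnion.2 ⟨τ, by simpa [hB, dist_eq_norm] using hτ, hy2⟩
      · intro hy
        obtain ⟨τ, hτ, hy2⟩ := Set.mem_iUnion.1 hy
        exact ⟨hBcube τ hτ, hy2⟩
    rw [e1, integral_iUnion_fintype]
    · have e2 : ∀ τ, ∫ y in B τ ∩ {y | ψ y ≤ r ^ 2}, Φ y
          = ∫ y in Metric.ball (regularTail k) ρ ∩ {y | ψ y ≤ r ^ 2}, Φ y := by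
        intro τ
        rw [← (measurePreserving_comp_perm τ.symm).setIntegral_preimage_emb
          (measurableEmbedding_comp_perm τ.symm) Φ
          (Metric.ball (regularTail k) ρ ∩ {y | ψ y ≤ r ^ 2})]
        have e3 : (fun (y : Fin k → ℝ) i => y (τ.symm i)) ⁻¹'
            (Metric.ball (regularTail k) ρ ∩ {y | ψ y ≤ r ^ 2}) = B τ ∩ {y | ψ y ≤ r ^ 2} := by
          ext y
          have e4 : dist (fun i => y (τ.symm i)) (regularTail k)
              = dist y fun i => regularTail k (τ i) := by
            rw [dist_eq_norm, dist_eq_norm,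
              ← norm_comp_perm (y - fun i => regularTail k (τ i)) τ.symm]
            congr 1
            ext i
            simp
          simp only [Set.mem_preimage, Set.mem_inter_iff, Metric.mem_ball, e4, hB,
            Set.mem_ofPred_eq, hψ, pairSum_consZero_comp_perm heven]
        rw [e3]
        exact integral_congr_ae (ae_of_all _ fun y => (hΦperm y τ.symm).symm)
      simp only [e2, Finset.sum_const, Finset.card_univ, Fintype.card_perm, Fintype.card_fin,
        nsmul_eq_mul]
    · exact fun τ => Metric.isOpen_ball.measurableSet.inter (hSm r)
    · exact fun τ τ' hne => (hdisj hne).mono Set.inter_subset_left Set.inter_subset_left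
    · intro τ
      refine IntegrableOn.mono_set ?_
        (Set.inter_subset_left.trans Metric.ball_subset_closedBall)
      exact hΦ.continuousOn.integrableOn_compact (isCompact_closedBall _ _)
  refine (hlap.const_mul (k.factorial : ℝ)).congr' ?_
  have hsmall : ∀ᶠ r : ℝ in 𝓝[>] 0, r ^ 2 < ε := by
    have : Tendsto (fun r : ℝ => r ^ 2) (𝓝[>] 0) (𝓝 0) := by
      have h1 : Continuous fun r : ℝ => r ^ 2 := by fun_prop
      simpa using (h1.tendsto 0).mono_left nhdsWithin_le_nhds
    exact this.eventually_lt_const hε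
  filter_upwards [hsmall, self_mem_nhdsWithin] with r hr1 hr2
  rw [hS, hsplit r hr2 hr1]
  ring

end CubeIntegral

/-! ### Rotation invariance and product densities -/

section Law

/-- The law of the polar angle, with density `p` on `[0, 2π)`. -/
def angleLaw (p : ℝ → ℝ) : Measure ℝ :=
  (volume.restrict (Set.Ico 0 (2 * Real.pi))).withDensity fun x => ENNReal.ofReal (p x)

/-- Any two half-open intervals of length T are fundamental domains for the translations by
multiples of T. -/
lemma setLIntegral_Ico_add {f : ℝ → ENNReal} {T : ℝ} (hT : 0 < T) (hf : Function.Periodic f T)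
    (x : ℝ) : ∫⁻ y in Set.Ico 0 T, f (y + x) = ∫⁻ y in Set.Ico 0 T, f y := by
  have h1 := (measurePreserving_add_right volume x).setLIntegral_comp_preimage_emb
    (MeasurableEquiv.addRight x).measurableEmbedding f (Set.Ioc x (x + T))
  rw [Set.preimage_add_const_Ioc] at h1
  simp only [sub_self, add_sub_cancel_left] at h1
  have : VAddInvariantMeasure (AddSubgroup.zmultiples T) ℝ volume :=
    ⟨fun c s _ => measure_preimage_add _ _ _⟩
  have h2 := IsAddFundamentalDomain.setLIntegral_eq (G := AddSubgroup.zmultiples T)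
    (isAddFundamentalDomain_Ioc hT x) (isAddFundamentalDomain_Ioc hT 0) f hf.map_vadd_zmultiples
  rw [zero_add] at h2
  rw [restrict_Ico_eq_restrict_Ioc, h1, h2]

lemma measurable_toIcoMod {T : ℝ} (hT : 0 < T) : Measurable (toIcoMod hT 0) := by
  have : toIcoMod hT 0 = fun x => Int.fract (x / T) * T := by
    ext x
    rw [toIcoMod_eq_add_fract_mul]
    simp
  rw [this]
  exact (measurable_fract.comp (measurable_id.div_const T)).mul_const T

lemma measurePreserving_toIcoMod_add {T : ℝ} (hT : 0 < T) (x : ℝ) :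
    MeasurePreserving (fun y => toIcoMod hT 0 (y + x)) (volume.restrict (Set.Ico 0 T))
      (volume.restrict (Set.Ico 0 T)) := by
  have hm : Measurable fun y => toIcoMod hT 0 (y + x) :=
    (measurable_toIcoMod hT).comp (measurable_id.add_const x)
  refine ⟨hm, ?_⟩
  ext s hs
  rw [Measure.map_apply hm hs, ← lintegral_indicator_one hs, ← lintegral_indicator_one (hm hs)]
  have h1 := setLIntegral_Ico_add (f := fun y => s.indicator 1 (toIcoMod hT 0 y)) hT
    (fun y => by simp) x
  refine Eq.trans ?_ (h1.trans ?_)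
  · rfl
  · refine setLIntegral_congr_fun measurableSet_Ico fun y hy => ?_
    rw [(toIcoMod_eq_self hT).2 (by simpa using hy)]

lemma lintegral_pi_add {k : ℕ} {T : ℝ} (hT : 0 < T) {H : (Fin k → ℝ) → ENNReal}
    (hH : Measurable H)
    (hper : ∀ (y : Fin k → ℝ) (n : Fin k → ℤ), H (fun i => y i + n i * T) = H y) (x : ℝ) :
    ∫⁻ y, H (fun i => y i + x) ∂(Measure.pi fun _ : Fin k => volume.restrict (Set.Ico 0 T))
      = ∫⁻ y, H y ∂(Measure.pi fun _ : Fin k => volume.restrict (Set.Ico 0 T)) := by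
  have h1 := measurePreserving_pi (fun _ : Fin k => volume.restrict (Set.Ico 0 T))
    (fun _ : Fin k => volume.restrict (Set.Ico 0 T))
    fun _ => measurePreserving_toIcoMod_add hT x
  rw [← h1.lintegral_comp hH]
  refine lintegral_congr fun y => ?_
  rw [← hper (fun i => y i + x) fun i => -toIcoDiv hT 0 (y i + x)]
  congr 1
  ext i
  rw [← self_sub_toIcoDiv_zsmul, zsmul_eq_mul]
  push_cast
  ring

/-- It suffices to compare boxes, where the integral of the product factorises. -/
lemma pi_withDensity_ofReal {ι α : Type*} [Fintype ι] [MeasurableSpace α] {μ : Measure α}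
    [IsFiniteMeasure μ] {p : α → ℝ} (hp : ∀ x, 0 ≤ p x)
    (hint : Integrable p μ) :
    (Measure.pi fun _ : ι => μ.withDensity fun x => ENNReal.ofReal (p x))
      = (Measure.pi fun _ : ι => μ).withDensity fun x => ENNReal.ofReal (∏ i, p (x i)) := by
  have hsf : IsFiniteMeasure (μ.withDensity fun x => ENNReal.ofReal (p x)) :=
    isFiniteMeasure_withDensity_ofReal hint.2
  refine Measure.pi_eq fun s hs => ?_
  rw [withDensity_apply _ (MeasurableSet.univ_pi hs),
    ← lintegral_indicator (MeasurableSet.univ_pi hs)]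
  have e1 : ∀ x : ι → α, (Set.univ.pi s).indicator
      (fun x => ENNReal.ofReal (∏ i, p (x i))) x
      = ENNReal.ofReal (∏ i, (s i).indicator p (x i)) := by
    intro x
    by_cases hx : x ∈ Set.univ.pi s
    · rw [Set.indicator_of_mem hx]
      congr 1
      exact Finset.prod_congr rfl fun i _ => (Set.indicator_of_mem (hx i (Set.mem_univ i)) p).symm
    · rw [Set.indicator_of_notMem hx]
      simp only [Set.mem_pi, Set.mem_univ, true_implies, not_forall] at hx
      obtain ⟨i, hi⟩ := hx
      rw [Finset.prod_eq_zero (Finset.mem_univ i) (Set.indicator_of_notMem hi p),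
        ENNReal.ofReal_zero]
  have hnn : ∀ (i : ι) (x : α), 0 ≤ (s i).indicator p x := fun i x =>
    Set.indicator_nonneg (fun _ _ => hp _) x
  have hinti : ∀ i, Integrable ((s i).indicator p) μ := fun i => hint.indicator (hs i)
  rw [lintegral_congr e1, ← ofReal_integral_eq_lintegral_ofReal
    (Integrable.fintype_prod hinti) (ae_of_all _ fun x => Finset.prod_nonneg fun i _ => hnn i _),
    integral_fintype_prod_eq_prod, ENNReal.ofReal_prod_of_nonneg fun i _ =>
      integral_nonneg (hnn i)]
  refine Finset.prod_congr rfl fun i _ => ?_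
  rw [withDensity_apply _ (hs i), ofReal_integral_eq_lintegral_ofReal (hinti i)
    (ae_of_all _ (hnn i)), ← lintegral_indicator (hs i)]
  refine lintegral_congr fun x => ?_
  by_cases hx : x ∈ s i <;> simp [hx]

end Law

/-! ### Law of the differences of the angles -/

section Density

variable {k : ℕ} {h p : ℝ → ℝ}

/-- The density at `y` of the differences of `k + 1` independent angles with density `p`. -/
def differenceDensity (p : ℝ → ℝ) (k : ℕ) (y : Fin k → ℝ) : ℝ :=
  ∫ x in (0 : ℝ)..(2 * Real.pi), p x * ∏ i, p (y i + x)

lemma continuous_differenceDensity (hp : Continuous p) : Continuous (differenceDensity p k) := by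
  unfold differenceDensity
  refine intervalIntegral.continuous_parametric_intervalIntegral_of_continuous' ?_ _ _
  simp only [Function.uncurry_def]
  fun_prop

lemma differenceDensity_nonneg (hp : ∀ x, 0 ≤ p x) (y : Fin k → ℝ) :
    0 ≤ differenceDensity p k y :=
  intervalIntegral.integral_nonneg Real.two_pi_pos.le fun x _ =>
    mul_nonneg (hp x) (Finset.prod_nonneg fun _ _ => hp _)

lemma differenceDensity_comp_perm (y : Fin k → ℝ) (τ : Equiv.Perm (Fin k)) :
    differenceDensity p k (fun i => y (τ i)) = differenceDensity p k y := by
  unfold differenceDensity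
  congr 1
  ext x
  congr 1
  exact Equiv.prod_comp τ fun i => p (y i + x)

lemma differenceDensity_regularTail :
    differenceDensity p k (regularTail k) = densityIntegral p (k + 1) := by
  unfold differenceDensity densityIntegral
  congr 1
  ext x
  rw [Finset.prod_range, Fin.prod_univ_succ]
  congr 1
  · simp
  · refine Finset.prod_congr rfl fun i _ => ?_
    simp only [regularTail, Fin.val_succ]
    rw [add_comm]
    push_cast
    rfl

lemma pi_restrict_Ico (k : ℕ) :
    (Measure.pi fun _ : Fin k => (volume : Measure ℝ).restrict (Set.Ico 0 (2 * Real.pi)))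
      = volume.restrict (Set.univ.pi fun _ : Fin k => Set.Ico 0 (2 * Real.pi)) :=
  (Measure.restrict_pi_pi (fun _ : Fin k => (volume : Measure ℝ)) _).symm

/-- The probability that the pair sum of independent angles is at least `b`, as an integral over
the differences of the angles. -/
lemma pi_angleLaw_superlevel (hh : Continuous h) (hper : Function.Periodic h (2 * Real.pi))
    (hp : Continuous p) (hp0 : ∀ x, 0 ≤ p x) (hpper : Function.Periodic p (2 * Real.pi)) (b : ℝ) :
    (Measure.pi fun _ : Fin (k + 1) => angleLaw p).real
        {θ | (∀ i, θ i ∈ Set.Ico 0 (2 * Real.pi)) ∧ b ≤ pairSum h θ}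
      = ∫ y in Set.univ.pi fun _ : Fin k => Set.Ico 0 (2 * Real.pi),
        {y | b ≤ pairSum h (consZero y)}.indicator (differenceDensity p k) y := by
  set ν₀ : Measure ℝ := volume.restrict (Set.Ico 0 (2 * Real.pi)) with hν₀
  have hfin : IsFiniteMeasure ν₀ := ⟨by
    rw [hν₀, Measure.restrict_apply_univ]
    exact measure_Ico_lt_top⟩
  set B : Set (Fin (k + 1) → ℝ) := {θ | b ≤ pairSum h θ} with hB
  have hBm : MeasurableSet B := measurableSet_le measurable_const (continuous_pairSum hh).measurable
  set B₀ : Set (Fin k → ℝ) := {y | b ≤ pairSum h (consZero y)} with hB₀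
  have hB₀m : MeasurableSet B₀ := measurableSet_le measurable_const
    ((continuous_pairSum hh).comp continuous_consZero).measurable
  set cube : Set (Fin (k + 1) → ℝ) := Set.univ.pi fun _ => Set.Ico 0 (2 * Real.pi) with hcube
  have hcubem : MeasurableSet cube := MeasurableSet.univ_pi fun _ => measurableSet_Ico
  have hA : {θ : Fin (k + 1) → ℝ | (∀ i, θ i ∈ Set.Ico 0 (2 * Real.pi)) ∧ b ≤ pairSum h θ}
      = cube ∩ B := by
    ext θ
    simp [hcube, hB, Set.mem_pi]
  have hpint : Integrable p ν₀ := by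
    have : IntegrableOn p (Set.Icc 0 (2 * Real.pi)) :=
      hp.continuousOn.integrableOn_compact isCompact_Icc
    exact this.mono_set Set.Ico_subset_Icc_self
  have hprodc : Continuous fun θ : Fin (k + 1) → ℝ => ∏ i, p (θ i) := by fun_prop
  set G : (Fin (k + 1) → ℝ) → ENNReal :=
    B.indicator fun θ => ENNReal.ofReal (∏ i, p (θ i)) with hG
  have hGm : Measurable G := (ENNReal.measurable_ofReal.comp hprodc.measurable).indicator hBm
  -- Periodicity in each coordinate allows angles to be shifted without tracking the cube.
  have hGper : ∀ (θ : Fin (k + 1) → ℝ) (n : Fin (k + 1) → ℤ),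
      G (fun i => θ i + n i * (2 * Real.pi)) = G θ := by
    intro θ n
    have e1 : pairSum h (fun i => θ i + n i * (2 * Real.pi)) = pairSum h θ :=
      pairSum_congr_of_periodic hper fun i => ⟨n i, rfl⟩
    have e2 : ∏ i, p (θ i + n i * (2 * Real.pi)) = ∏ i, p (θ i) :=
      Finset.prod_congr rfl fun i _ => hpper.int_mul _ _
    by_cases hθ : θ ∈ B
    · rw [hG, Set.indicator_of_mem hθ, Set.indicator_of_mem (by simpa only [hB,
        Set.mem_ofPred_eq, e1] using hθ), e2]
    · rw [hG, Set.indicator_of_notMem hθ, Set.indicator_of_notMem (by simpa only [hB,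
        Set.mem_ofPred_eq, e1] using hθ)]
  have step1 : (Measure.pi fun _ : Fin (k + 1) => angleLaw p) (cube ∩ B)
      = ∫⁻ θ, G θ ∂(Measure.pi fun _ : Fin (k + 1) => ν₀) := by
    have e0 : (Measure.pi fun _ : Fin (k + 1) => angleLaw p)
        = (Measure.pi fun _ : Fin (k + 1) => ν₀).withDensity
          fun θ => ENNReal.ofReal (∏ i, p (θ i)) := pi_withDensity_ofReal hp0 hpint
    rw [e0, withDensity_apply _ (hcubem.inter hBm), hG, lintegral_indicator hBm, hν₀,
      pi_restrict_Ico, Measure.restrict_restrict (hcubem.inter hBm),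
      Measure.restrict_restrict hBm]
    congr 2
    ext θ
    simp only [Set.mem_inter_iff]
    tauto
  have step2 : ∫⁻ θ, G θ ∂(Measure.pi fun _ : Fin (k + 1) => ν₀)
      = ∫⁻ x, ∫⁻ y, G (Fin.cons x y) ∂(Measure.pi fun _ : Fin k => ν₀) ∂ν₀ := by
    have e1 := (measurePreserving_piFinSuccAbove (fun _ : Fin (k + 1) => ν₀) 0).symm
    refine (e1.lintegral_comp hGm).symm.trans
      ((lintegral_prod _ (hGm.comp e1.measurable).aemeasurable).trans ?_)
    refine lintegral_congr fun x => lintegral_congr fun y => ?_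
    refine congrArg G ?_
    simp [MeasurableEquiv.piFinSuccAbove, Fin.insertNthEquiv]
  have hcons : Continuous fun z : ℝ × (Fin k → ℝ) =>
      (fun i => consZero z.2 i + z.1 : Fin (k + 1) → ℝ) := by
    refine continuous_pi fun i => ?_
    exact ((continuous_apply i).comp (continuous_consZero.comp continuous_snd)).add continuous_fst
  -- Shifting the last k angles by the first turns them into differences. By rotation invariance the
  -- event then no longer involves x, so x can be integrated out.
  have step3 : ∀ x, ∫⁻ y, G (Fin.cons x y) ∂(Measure.pi fun _ : Fin k => ν₀)
      = ∫⁻ y, G (fun i => consZero y i + x) ∂(Measure.pi fun _ : Fin k => ν₀) := by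
    intro x
    have hcm : Measurable fun y : Fin k → ℝ => (Fin.cons x y : Fin (k + 1) → ℝ) := by
      refine measurable_pi_lambda _ fun i => ?_
      refine Fin.cases ?_ (fun i => ?_) i
      · simp
      · simpa using measurable_pi_apply i
    refine (lintegral_pi_add Real.two_pi_pos (hGm.comp hcm) ?_ x).symm.trans ?_
    rotate_left
    · refine lintegral_congr fun y => ?_
      refine congrArg G ?_
      ext i
      refine Fin.cases ?_ (fun i => ?_) i <;> simp
    · intro y n
      simp only [Function.comp_apply]
      rw [← hGper (Fin.cons x y) (Fin.cons 0 n)]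
      refine congrArg G ?_
      ext i
      refine Fin.cases ?_ (fun i => ?_) i <;> simp
  have step4 : ∀ x (y : Fin k → ℝ), G (fun i => consZero y i + x)
      = B₀.indicator (fun y => ENNReal.ofReal (p x * ∏ i, p (y i + x))) y := by
    intro x y
    have e1 : ∏ i, p (consZero y i + x) = p x * ∏ i, p (y i + x) := by
      rw [Fin.prod_univ_succ]
      simp
    by_cases hy : y ∈ B₀
    · rw [Set.indicator_of_mem hy, hG, Set.indicator_of_mem, e1]
      simpa only [hB, hB₀, Set.mem_ofPred_eq, pairSum_add_const] using hy
    · rw [Set.indicator_of_notMem hy, hG, Set.indicator_of_notMem]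
      simpa only [hB, hB₀, Set.mem_ofPred_eq, pairSum_add_const] using hy
  have step5 : ∀ y : Fin k → ℝ, ∫⁻ x, G (fun i => consZero y i + x) ∂ν₀
      = ENNReal.ofReal (B₀.indicator (differenceDensity p k) y) := by
    intro y
    simp only [step4]
    by_cases hy : y ∈ B₀
    · simp only [Set.indicator_of_mem hy]
      have hyc : Continuous fun x => p x * ∏ i, p (y i + x) := by fun_prop
      rw [differenceDensity, intervalIntegral.integral_of_le Real.two_pi_pos.le,
        ← integral_Ico_eq_integral_Ioc, ofReal_integral_eq_lintegral_ofReal]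
      · exact (hyc.continuousOn.integrableOn_compact isCompact_Icc).mono_set
          Set.Ico_subset_Icc_self
      · exact ae_of_all _ fun x => mul_nonneg (hp0 x) (Finset.prod_nonneg fun i _ => hp0 _)
    · simp only [Set.indicator_of_notMem hy]
      simp
  rw [hA, Measure.real, step1, step2, lintegral_congr step3, lintegral_lintegral_swap,
    lintegral_congr step5, integral_eq_lintegral_of_nonneg_ae, hν₀, pi_restrict_Ico]
  · exact ae_of_all _ fun y => Set.indicator_nonneg (fun y _ => differenceDensity_nonneg hp0 y) y
  · exact ((continuous_differenceDensity hp).measurable.indicator hB₀m).aestronglyMeasurable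
  · exact (hGm.comp hcons.measurable).aemeasurable

/-- A set of angles close to finitely many points has small probability. -/
lemma angleLaw_near_le {C : ℝ} (hpC : ∀ x, p x ≤ C) (s : Finset ℤ) (c : ℤ → ℝ) {δ : ℝ}
    (hδ : 0 ≤ δ) :
    angleLaw p {y | ∃ l ∈ s, |y - c l| ≤ δ} ≤ ENNReal.ofReal (s.card * (C * (2 * δ))) := by
  have h1 : ∀ l, angleLaw p (Metric.closedBall (c l) δ) ≤ ENNReal.ofReal (C * (2 * δ)) := by
    intro l
    have hball : MeasurableSet (Metric.closedBall (c l) δ) :=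
      Metric.isClosed_closedBall.measurableSet
    rw [angleLaw, withDensity_apply _ hball]
    calc _ ≤ ∫⁻ _ in Metric.closedBall (c l) δ, ENNReal.ofReal C
            ∂(volume.restrict (Set.Ico 0 (2 * Real.pi))) :=
          lintegral_mono fun x => ENNReal.ofReal_le_ofReal (hpC x)
      _ ≤ ENNReal.ofReal C * volume (Metric.closedBall (c l) δ) := by
          rw [setLIntegral_const]
          gcongr
          exact Measure.restrict_le_self
      _ = _ := by
          rw [Real.volume_closedBall, ← ENNReal.ofReal_mul' (by positivity)]
  have h2 : {y | ∃ l ∈ s, |y - c l| ≤ δ} = ⋃ l ∈ s, Metric.closedBall (c l) δ := by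
    ext y
    simp [Real.dist_eq]
  rw [h2]
  refine (measure_biUnion_finset_le s _).trans ((Finset.sum_le_sum fun l _ => h1 l).trans ?_)
  rw [Finset.sum_const, nsmul_eq_mul, ENNReal.ofReal_mul (Nat.cast_nonneg _),
    ENNReal.ofReal_natCast]

end Density

/-! ### Polar angles of points of the circle -/

section Angles

/-- The polar angle in `[0, 2π)`. -/
def polarAngle (u : Circle) : ℝ := ccwAngle 1 u

lemma polarAngle_mem (u : Circle) : polarAngle u ∈ Set.Ico 0 (2 * Real.pi) := by
  simpa [polarAngle, ccwAngle] using toIcoMod_mem_Ico Real.two_pi_pos 0 _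

lemma exp_polarAngle (u : Circle) : Circle.exp (polarAngle u) = u := by
  conv_rhs => rw [← Circle.exp_arg u]
  rw [polarAngle, ccwAngle, Circle.exp_eq_exp]
  refine ⟨-toIcoDiv Real.two_pi_pos 0 (Complex.arg u), ?_⟩
  rw [div_one, ← self_sub_toIcoDiv_zsmul, zsmul_eq_mul]
  push_cast
  ring

lemma polarAngle_exp {x : ℝ} (hx : x ∈ Set.Ico 0 (2 * Real.pi)) :
    polarAngle (Circle.exp x) = x := by
  obtain ⟨n, hn⟩ := Circle.exp_eq_exp.1 (exp_polarAngle (Circle.exp x))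
  have h1 := polarAngle_mem (Circle.exp x)
  rw [hn] at h1 ⊢
  have hpi := Real.two_pi_pos
  have h2 : n = 0 := by
    by_contra hne
    rcases lt_or_gt_of_ne hne with h | h
    · have : (n : ℝ) ≤ -1 := by exact_mod_cast (by omega : n ≤ -1)
      nlinarith [h1.1, hx.2]
    · have : (1 : ℝ) ≤ n := by exact_mod_cast h
      nlinarith [h1.2, hx.1]
  simp [h2]

lemma measurable_polarAngle : Measurable polarAngle := by
  unfold polarAngle ccwAngle
  simp only [div_one]
  exact (measurable_toIcoMod Real.two_pi_pos).comp
    (Complex.measurable_arg.comp (by fun_prop : Continuous fun u : Circle => (u : ℂ)).measurable)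

lemma map_polarAngle_circleLaw (p : ℝ → ℝ) : (circleLaw p).map polarAngle = angleLaw p := by
  have hae : ∀ᵐ x ∂(angleLaw p), (polarAngle ∘ Circle.exp) x = id x := by
    have h1 : ∀ᵐ x ∂(volume.restrict (Set.Ico 0 (2 * Real.pi))),
        (polarAngle ∘ Circle.exp) x = id x := by
      filter_upwards [ae_restrict_mem measurableSet_Ico] with x hx
      exact polarAngle_exp hx
    exact (withDensity_absolutelyContinuous _ _).ae_le h1
  rw [circleLaw, Measure.map_map measurable_polarAngle Circle.exp.continuous.measurable]
  exact (Measure.map_congr hae).trans Measure.map_id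

end Angles

/-! ### Scaling and the Poisson limit -/

section Assembly

variable {k : ℕ} {g p : ℝ → ℝ}

lemma periodicExt_eventuallyEq (hg : g 0 = g (2 * Real.pi)) {x : ℝ}
    (hx : x ∈ Set.Ioo 0 (2 * Real.pi)) : periodicExt g =ᶠ[𝓝 x] g := by
  filter_upwards [Ioo_mem_nhds hx.1 hx.2] with y hy
  exact periodicExt_eq hg (Set.Ioo_subset_Icc_self hy)

lemma vertex_angle_mem {s : ℕ} (hs : s ∈ Finset.Icc 1 k) :
    2 * Real.pi * s / (k + 1 : ℕ) ∈ Set.Ioo 0 (2 * Real.pi) := by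
  rw [Finset.mem_Icc] at hs
  have h1 : (0 : ℝ) < s := by exact_mod_cast hs.1
  have h2 : (s : ℝ) < (k + 1 : ℕ) := by exact_mod_cast (by omega : s < k + 1)
  have hpi := Real.pi_pos
  refine ⟨by positivity, ?_⟩
  rw [div_lt_iff₀ (by positivity)]
  exact mul_lt_mul_of_pos_left h2 Real.two_pi_pos

lemma secondDerivAt_periodicExt (hg : g 0 = g (2 * Real.pi)) {s : ℕ}
    (hs : s ∈ Finset.Icc 1 k) :
    secondDerivAt (periodicExt g) (k + 1) s = iteratedDeriv 2 g (2 * Real.pi * s / (k + 1 : ℕ)) := by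
  rw [secondDerivAt, Int.cast_natCast]
  exact (periodicExt_eventuallyEq hg (vertex_angle_mem hs)).iteratedDeriv_eq 2

/-- Off the diagonal the angle 2π|i - j|/(k+1) is interior to (0, 2π), where g and its extension
coincide locally; evenness covers the sign of j - i. -/
lemma matG_apply (hsymm : ∀ x ∈ Set.Icc 0 (2 * Real.pi), g x = g (2 * Real.pi - x))
    (i j : Fin k) : matG g (k + 1) i j
      = if i = j then ∑ s ∈ Finset.Icc 1 k, secondDerivAt (periodicExt g) (k + 1) s
        else -secondDerivAt (periodicExt g) (k + 1) ((j : ℕ) - (i : ℕ)) := by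
  have h0 : g 0 = g (2 * Real.pi) := by
    simpa using hsymm 0 ⟨le_rfl, Real.two_pi_pos.le⟩
  rw [matG, Matrix.of_apply]
  by_cases hij : i = j
  · rw [if_pos hij, if_pos hij]
    exact Finset.sum_congr rfl fun s hs => (secondDerivAt_periodicExt h0 hs).symm
  · rw [if_neg hij, if_neg hij]
    congr 1
    have hi := i.2
    have hj := j.2
    have hne : (i : ℕ) ≠ j := fun h => hij (Fin.ext h)
    rcases lt_or_gt_of_ne hne with h | h
    · have e1 : ((j : ℕ) : ℤ) - (i : ℕ) = ((j - i : ℕ) : ℕ) := by omega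
      have e2 : |((i : ℕ) : ℝ) - ((j : ℕ) : ℝ)| = ((j - i : ℕ) : ℝ) := by
        rw [abs_sub_comm, Nat.cast_sub h.le]
        exact abs_of_pos (sub_pos.2 (by exact_mod_cast h))
      rw [e1, secondDerivAt_periodicExt h0 (Finset.mem_Icc.2 ⟨by omega, by omega⟩), ← e2]
    · have e1 : ((j : ℕ) : ℤ) - (i : ℕ) = -((i - j : ℕ) : ℕ) := by omega
      have e2 : |((i : ℕ) : ℝ) - ((j : ℕ) : ℝ)| = ((i - j : ℕ) : ℝ) := by
        rw [Nat.cast_sub h.le]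
        exact abs_of_pos (sub_pos.2 (by exact_mod_cast h))
      rw [e1, secondDerivAt_neg (periodicExt_neg hsymm),
        secondDerivAt_periodicExt h0 (Finset.mem_Icc.2 ⟨by omega, by omega⟩), ← e2]

lemma onlyRegularMax_periodicExt [NeZero (k + 1)]
    (hsymm : ∀ x ∈ Set.Icc 0 (2 * Real.pi), g x = g (2 * Real.pi - x))
    (hmax : ∀ V : Fin (k + 1) → Circle,
      IsMaxOn (kernel g) Set.univ V → IsRegularPolygon V) :
    OnlyRegularMax k (periodicExt g) := by
  intro θ hθ
  obtain ⟨z, σ, hσ⟩ := hmax (fun i => Circle.exp (θ i)) (by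
    intro V _
    have hV : V = fun i => Circle.exp (polarAngle (V i)) :=
      funext fun i => (exp_polarAngle (V i)).symm
    simp only [Set.mem_ofPred_eq]
    rw [kernel_exp hsymm, hV, kernel_exp hsymm]
    exact hθ _)
  refine ⟨polarAngle z, σ, fun i => ?_⟩
  have h1 := hσ i
  rw [← exp_polarAngle z, ← Circle.exp_add] at h1
  obtain ⟨n, hn⟩ := Circle.exp_eq_exp.1 h1
  refine ⟨n, ?_⟩
  rw [hn, regularAngles]
  ring

lemma localExpansion_periodicExt (hcont : ContinuousOn g (Set.Icc 0 (2 * Real.pi)))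
    (hsymm : ∀ x ∈ Set.Icc 0 (2 * Real.pi), g x = g (2 * Real.pi - x))
    (hsmooth : ∀ s ∈ Finset.Icc 1 k, ContDiffAt ℝ 3 g (2 * Real.pi * s / (k + 1 : ℕ)))
    (hmax : OnlyRegularMax k (periodicExt g)) (hG : (matG g (k + 1)).det ≠ 0) :
    LocalExpansion k (periodicExt g) (-matG g (k + 1)) := by
  have h0 : g 0 = g (2 * Real.pi) := by
    simpa using hsymm 0 ⟨le_rfl, Real.two_pi_pos.le⟩
  have heven := periodicExt_neg hsymm
  have hper := periodicExt_periodic g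
  have hc := continuous_periodicExt hcont h0
  set h := periodicExt g with hh
  set G : Matrix (Fin k) (Fin k) ℝ := matG g (k + 1) with hGdef
  have hGapp : ∀ i j : Fin k, G i j = if i = j then ∑ s ∈ Finset.Icc 1 k, secondDerivAt h (k + 1) s
        else -secondDerivAt h (k + 1) ((j : ℕ) - (i : ℕ)) := fun i j => matG_apply hsymm i j
  obtain ⟨L, hL⟩ := exists_isLittleO_pairSum (k := k) (h := h) fun s hs =>
    ((hsmooth s hs).of_le (by norm_num)).congr_of_eventuallyEq
      (periodicExt_eventuallyEq h0 (vertex_angle_mem hs))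
  simp only [sum_secondDerivAt_mul_sq heven hper hGapp] at hL
  have hsymmG : (-G).IsHermitian := by
    refine Matrix.IsHermitian.ext fun i j => ?_
    simp only [Matrix.neg_apply, star_trivial, hGapp]
    by_cases hij : i = j
    · rw [if_pos hij, if_pos hij.symm]
    · rw [if_neg hij, if_neg (Ne.symm hij), ← secondDerivAt_neg heven, neg_sub]
  have hdet : (-G).det ≠ 0 := by
    rw [Matrix.det_neg]
    exact mul_ne_zero (pow_ne_zero _ (by norm_num)) hG
  have hF0 : (fun i => regularAngles (k + 1) i + consZero (0 : Fin k → ℝ) i)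
      = regularAngles (k + 1) := by
    ext i
    refine Fin.cases ?_ (fun i => ?_) i <;> simp
  have key := posDef_of_isMax (A := -G) (L := L)
    (F := fun y => pairSum h fun i => regularAngles (k + 1) i + consZero y i) hsymmG hdet
    (fun y => by rw [hF0]; exact pairSum_le_regularAngles hc heven hper hmax _)
    (by
      rw [hF0]
      refine hL.congr_left fun y => ?_
      rw [Matrix.neg_mulVec, dotProduct_neg]
      ring)
  refine ⟨key.1, key.2.congr_left fun y => ?_⟩
  rw [hF0]
  congr 3
  ext i
  rw [consZero_add, consZero_regularTail]

/-- The probability of an increasing tuple with nearly maximal pair sum. -/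
lemma tendsto_superlevel_prob (hk : 0 < k) (hp : Continuous p) (hp0 : ∀ x, 0 ≤ p x)
    (hpper : Function.Periodic p (2 * Real.pi)) {h : ℝ → ℝ} (hc : Continuous h)
    (heven : ∀ x, h (-x) = h x) (hper : Function.Periodic h (2 * Real.pi))
    (hmax : OnlyRegularMax k h) {A : Matrix (Fin k) (Fin k) ℝ} (hA : LocalExpansion k h A) :
    Tendsto (fun r : ℝ => (r ^ k)⁻¹ * (Measure.pi fun _ : Fin (k + 1) => angleLaw p).real
        {θ | (∀ i, θ i ∈ Set.Ico 0 (2 * Real.pi)) ∧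
          pairSum h (regularAngles (k + 1)) - r ^ 2 ≤ pairSum h θ}) (𝓝[>] 0)
      (𝓝 (k.factorial * ((2 * Real.pi) ^ ((k : ℝ) / 2) * densityIntegral p (k + 1)
        / (Real.sqrt A.det * Real.Gamma ((k : ℝ) / 2 + 1))))) := by
  simp only [pi_angleLaw_superlevel hc hper hp hp0 hpper]
  have := tendsto_setIntegral_cube hk hc heven hper hmax hA
    (continuous_differenceDensity (k := k) hp) differenceDensity_comp_perm
  rw [volume_ellipsoid hk hA.posDef, differenceDensity_regularTail] at this
  convert this using 2
  ring

/-- Squeeze between 1 and exp(n a). -/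
lemma tendsto_one_add_pow_of_tendsto_mul {a : ℕ → ℝ} (ha : ∀ n, 0 ≤ a n)
    (hna : Tendsto (fun n : ℕ => n * a n) atTop (𝓝 0)) :
    Tendsto (fun n : ℕ => (1 + a n) ^ n) atTop (𝓝 1) := by
  refine tendsto_of_tendsto_of_tendsto_of_le_of_le tendsto_const_nhds
    (h := fun n : ℕ => Real.exp (n * a n)) ?_ (fun n => ?_) fun n => ?_
  · rw [← Real.exp_zero]
    exact (Real.continuous_exp.tendsto 0).comp hna
  · exact one_le_pow₀ (by linarith [ha n])
  · have h1 : 1 + a n ≤ Real.exp (a n) := by linarith [Real.add_one_le_exp (a n)]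
    calc (1 + a n) ^ n ≤ Real.exp (a n) ^ n :=
          pow_le_pow_left₀ (by linarith [ha n]) h1 n
      _ = _ := by rw [← Real.exp_nat_mul]

lemma tendsto_choose_mul {m : ℕ} {q : ℕ → ℝ} {c : ℝ}
    (hq : Tendsto (fun n : ℕ => (n : ℝ) ^ m * q n) atTop (𝓝 c)) :
    Tendsto (fun n : ℕ => (n.choose m : ℝ) * q n) atTop (𝓝 (c / m.factorial)) := by
  have h1 : Asymptotics.IsEquivalent atTop (fun n : ℕ => (n.choose m : ℝ) * q n)
      fun n : ℕ => (n ^ m / m.factorial : ℝ) * q n :=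
    (isEquivalent_choose m).mul Asymptotics.IsEquivalent.refl
  refine h1.symm.tendsto_nhds ?_
  refine (hq.div_const (m.factorial : ℝ)).congr fun n => ?_
  ring

/-- The scale `√t n^{-m/(m-1)}` of the deviations from a regular polygon, with `m = k + 1`. -/
def deviationScale (t : ℝ) (k n : ℕ) : ℝ := Real.sqrt t * (n : ℝ) ^ (-(((k : ℝ) + 1) / k))

lemma deviationScale_pos {t : ℝ} (ht : 0 < t) {n : ℕ} (hn : 0 < n) : 0 < deviationScale t k n := by
  have : (0 : ℝ) < n := by exact_mod_cast hn
  unfold deviationScale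
  positivity

lemma deviationScale_sq {t : ℝ} (ht : 0 < t) {n : ℕ} :
    deviationScale t k n ^ 2 = t * ((n : ℝ) ^ (2 * ((k : ℝ) + 1) / k))⁻¹ := by
  rw [deviationScale, mul_pow, Real.sq_sqrt ht.le, ← Real.rpow_natCast,
    ← Real.rpow_mul (Nat.cast_nonneg n), ← Real.rpow_neg (Nat.cast_nonneg n)]
  congr 2
  push_cast
  ring

/-- The exponent of n in the scale is chosen for this identity: it keeps the expected number of
tuples of order one. -/
lemma pow_mul_deviationScale_pow (hk : 0 < k) {t : ℝ} (ht : 0 < t) {n : ℕ} (hn : 0 < n) :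
    (n : ℝ) ^ (k + 1) * deviationScale t k n ^ k = t ^ ((k : ℝ) / 2) := by
  have hn' : (0 : ℝ) < n := by exact_mod_cast hn
  have hk' : (0 : ℝ) < k := by exact_mod_cast hk
  rw [deviationScale, mul_pow, ← Real.rpow_natCast (_ ^ (_ : ℝ)) k, ← Real.rpow_mul hn'.le,
    ← Real.rpow_natCast (n : ℝ), mul_left_comm, ← Real.rpow_add hn', Real.sqrt_eq_rpow,
    ← Real.rpow_natCast, ← Real.rpow_mul ht.le]
  have e1 : ((k + 1 : ℕ) : ℝ) + -(((k : ℝ) + 1) / k) * (k : ℝ) = 0 := by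
    push_cast
    field_simp
    ring
  rw [e1, Real.rpow_zero, mul_one]
  congr 1
  ring

/-- The product is of order n^{-1/k}; its decay makes overlapping tuples negligible. -/
lemma tendsto_mul_deviationScale (hk : 0 < k) (t : ℝ) :
    Tendsto (fun n : ℕ => n * deviationScale t k n) atTop (𝓝 0) := by
  have hk' : (0 : ℝ) < k := by exact_mod_cast hk
  have h1 := ((tendsto_rpow_neg_atTop (y := 1 / (k : ℝ)) (by positivity)).comp
    tendsto_natCast_atTop_atTop).const_mul (Real.sqrt t)
  rw [mul_zero] at h1
  refine h1.congr' ?_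
  filter_upwards [eventually_gt_atTop 0] with n hn
  have hn' : (0 : ℝ) < n := by exact_mod_cast hn
  have e1 : -(1 / (k : ℝ)) = 1 + -(((k : ℝ) + 1) / k) := by
    field_simp
    ring
  rw [Function.comp_apply, deviationScale, mul_left_comm, e1, Real.rpow_add hn', Real.rpow_one]

lemma tendsto_deviationScale (hk : 0 < k) (t : ℝ) :
    Tendsto (fun n : ℕ => deviationScale t k n) atTop (𝓝 0) := by
  have h1 := (tendsto_mul_deviationScale hk t).mul
    (tendsto_inv_atTop_nhds_zero_nat (𝕜 := ℝ))
  rw [mul_zero] at h1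
  refine h1.congr' ?_
  filter_upwards [eventually_gt_atTop 0] with n hn
  have hn' : (0 : ℝ) < n := by exact_mod_cast hn
  field_simp

/-- Poisson limit for the number of increasing tuples of angles with nearly maximal pair sum:
the probability that there is none. -/
theorem tendsto_prob_no_tuple (hk : 0 < k) (hp : Continuous p) (hp0 : ∀ x, 0 ≤ p x)
    (hpper : Function.Periodic p (2 * Real.pi)) {h : ℝ → ℝ} (hc : Continuous h)
    (heven : ∀ x, h (-x) = h x) (hper : Function.Periodic h (2 * Real.pi))
    (hmax : OnlyRegularMax k h) {A : Matrix (Fin k) (Fin k) ℝ} (hA : LocalExpansion k h A)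
    {Ω : Type*} [MeasurableSpace Ω] {μ : Measure Ω} [IsProbabilityMeasure μ] {T : ℕ → Ω → ℝ}
    (hT : ∀ i, Measurable (T i)) (hind : iIndepFun T μ) (hlaw : ∀ i, μ.map (T i) = angleLaw p)
    (hTmem : ∀ i ω, T i ω ∈ Set.Ico 0 (2 * Real.pi)) {t : ℝ} (ht : 0 < t) :
    Tendsto (fun n : ℕ => μ.real {ω | ∀ α : Fin (k + 1) ↪o Fin n,
        ¬ pairSum h (regularAngles (k + 1)) - deviationScale t k n ^ 2
          ≤ pairSum h fun i => T (α i) ω}) atTop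
      (𝓝 (Real.exp (-(t ^ ((k : ℝ) / 2) * ((2 * Real.pi) ^ ((k : ℝ) / 2)
        * densityIntegral p (k + 1) / (Real.sqrt A.det * Real.Gamma ((k : ℝ) / 2 + 1)))
          / (k + 1 : ℕ))))) := by
  set M := pairSum h (regularAngles (k + 1)) with hM
  set K := (2 * Real.pi) ^ ((k : ℝ) / 2) * densityIntegral p (k + 1)
    / (Real.sqrt A.det * Real.Gamma ((k : ℝ) / 2 + 1)) with hK
  have hprob : IsProbabilityMeasure (angleLaw p) := by
    rw [← hlaw 0]
    exact Measure.isProbabilityMeasure_map (hT 0).aemeasurable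
  set S : ℕ → Set (Fin (k + 1) → ℝ) := fun n =>
    {θ | (∀ i, θ i ∈ Set.Ico 0 (2 * Real.pi)) ∧ M - deviationScale t k n ^ 2 ≤ pairSum h θ}
    with hS
  have hSm : ∀ n, MeasurableSet (S n) := by
    intro n
    have e1 : S n = (Set.univ.pi fun _ => Set.Ico 0 (2 * Real.pi))
        ∩ {θ | M - deviationScale t k n ^ 2 ≤ pairSum h θ} := by
      ext θ
      simp [hS, Set.mem_pi]
    rw [e1]
    exact (MeasurableSet.univ_pi fun _ => measurableSet_Ico).inter
      (measurableSet_le measurable_const (continuous_pairSum hc).measurable)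
  set q : ℕ → ℝ := fun n => (Measure.pi fun _ : Fin (k + 1) => angleLaw p).real (S n) with hq
  have hscale0 : Tendsto (fun n : ℕ => deviationScale t k n) atTop (𝓝[>] 0) :=
    tendsto_nhdsWithin_iff.2 ⟨tendsto_deviationScale hk t,
      (eventually_gt_atTop 0).mono fun n hn => deviationScale_pos ht hn⟩
  have hqlim : Tendsto (fun n : ℕ => (n : ℝ) ^ (k + 1) * q n) atTop
      (𝓝 (t ^ ((k : ℝ) / 2) * (k.factorial * K))) := by
    refine (((tendsto_superlevel_prob hk hp hp0 hpper hc heven hper hmax hA).comp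
      hscale0).const_mul (t ^ ((k : ℝ) / 2))).congr' ?_
    filter_upwards [eventually_gt_atTop 0] with n hn
    have h1 := deviationScale_pos (k := k) ht hn
    rw [Function.comp_apply, ← pow_mul_deviationScale_pow hk ht hn]
    field_simp
    rfl
  -- The k! orderings cancel against (k + 1)!, leaving the factor 1/m.
  have hlam : Tendsto (fun n : ℕ => (n.choose (k + 1) : ℝ) * q n) atTop
      (𝓝 (t ^ ((k : ℝ) / 2) * K / (k + 1 : ℕ))) := by
    convert tendsto_choose_mul hqlim using 2
    rw [Nat.factorial_succ]
    have := Nat.factorial_pos k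
    push_cast
    field_simp
  obtain ⟨C, hC, ε, hε, hnear⟩ := exists_int_abs_sub_le hc heven hper hmax hA
  obtain ⟨D, hD⟩ : ∃ D, ∀ x, p x ≤ D := by
    obtain ⟨D, hD⟩ := (isCompact_Icc (a := 0) (b := 2 * Real.pi)).exists_bound_of_continuousOn
      hp.continuousOn
    refine ⟨D, fun x => ?_⟩
    have h1 := toIcoMod_mem_Ico Real.two_pi_pos 0 x
    rw [zero_add] at h1
    have h2 : p (toIcoMod Real.two_pi_pos 0 x) = p x := by
      rw [← self_sub_toIcoDiv_zsmul]
      exact hpper.sub_zsmul_eq _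
    rw [← h2]
    exact (le_abs_self _).trans (hD _ (Set.Ico_subset_Icc_self h1))
  have hD0 : 0 ≤ D := (hp0 0).trans (hD 0)
  set Λ : Finset ℤ := Finset.Icc (-(k + 1 : ℕ) : ℤ) (k + 1 : ℕ) with hΛ
  -- Number of arcs, times the bound on the density, times the arc length per unit of the scale.
  set b : ℝ := Λ.card * (D * (2 * C)) with hb
  have hb0 : 0 ≤ b := by positivity
  set a : ℕ → ℝ := fun n => b * deviationScale t k n with ha
  have hr0 : ∀ n, 0 ≤ deviationScale t k n := fun n => by unfold deviationScale; positivity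
  have ha0 : ∀ n, 0 ≤ a n := fun n => mul_nonneg hb0 (hr0 n)
  have hna : Tendsto (fun n : ℕ => n * a n) atTop (𝓝 0) := by
    have := (tendsto_mul_deviationScale hk t).const_mul b
    rw [mul_zero] at this
    refine this.congr fun n => ?_
    simp only [ha]
    ring
  have halim : Tendsto a atTop (𝓝 0) := by
    simpa using (tendsto_deviationScale hk t).const_mul b
  have hpow := tendsto_one_add_pow_of_tendsto_mul ha0 hna
  have hak : Tendsto (fun n => a n ^ (k + 1 - 1)) atTop (𝓝 0) := by
    have := halim.pow (k + 1 - 1)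
    rwa [zero_pow (by omega)] at this
  have herr : Tendsto (fun n : ℕ => (n.choose (k + 1) : ℝ) * q n *
      (2 ^ (k + 1) * ((1 + a n) ^ n - 1 + a n ^ (k + 1 - 1))
        + 2 ^ (k + 1) * ((1 + a n) ^ n - 1))) atTop (𝓝 0) := by
    have h1 := hlam.mul ((((hpow.sub_const 1).add hak).const_mul (2 ^ (k + 1) : ℝ)).add
      ((hpow.sub_const 1).const_mul (2 ^ (k + 1) : ℝ)))
    simpa using h1
  have hbound : ∀ᶠ n : ℕ in atTop,
      |μ.real {ω | ∀ α : Fin (k + 1) ↪o Fin n, ¬ M - deviationScale t k n ^ 2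
          ≤ pairSum h fun i => T (α i) ω} - Real.exp (-((n.choose (k + 1) : ℝ) * q n))|
        ≤ (n.choose (k + 1) : ℝ) * q n *
      (2 ^ (k + 1) * ((1 + a n) ^ n - 1 + a n ^ (k + 1 - 1))
        + 2 ^ (k + 1) * ((1 + a n) ^ n - 1)) := by
    have hsq : Tendsto (fun n : ℕ => deviationScale t k n ^ 2) atTop (𝓝 0) := by
      simpa using (tendsto_deviationScale hk t).pow 2
    filter_upwards [eventually_gt_atTop 0, halim.eventually_lt_const one_pos,
      hsq.eventually_lt_const hε] with n hn han hεn
    set R : Set (ℝ × ℝ) := {z | ∃ l ∈ Λ,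
      |z.2 - (z.1 + 2 * Real.pi * l / (k + 1 : ℕ))| ≤ C * deviationScale t k n} with hR
    have hRm : MeasurableSet R := by
      have : R = ⋃ l ∈ Λ, {z : ℝ × ℝ |
          |z.2 - (z.1 + 2 * Real.pi * l / (k + 1 : ℕ))| ≤ C * deviationScale t k n} := by
        ext z
        simp [hR]
      rw [this]
      refine Finset.measurableSet_biUnion _ fun l _ => ?_
      refine measurableSet_le ?_ measurable_const
      exact (by fun_prop : Continuous fun z : ℝ × ℝ =>
        |z.2 - (z.1 + 2 * Real.pi * l / (k + 1 : ℕ))|).measurable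
    have hRa : ∀ x, angleLaw p {y | (x, y) ∈ R} ≤ ENNReal.ofReal (a n) := by
      intro x
      have h1 := angleLaw_near_le hD Λ (fun l => x + 2 * Real.pi * l / (k + 1 : ℕ))
        (mul_nonneg hC.le (hr0 n))
      refine h1.trans (le_of_eq ?_)
      congr 1
      simp only [ha, hb]
      ring
    have hmain := abs_measureReal_forall_tuple_notMem_sub_exp_le (n := n) (m := k + 1)
      (X := fun i : Fin n => T i) (μ := μ) (Nat.succ_pos k) (fun i => hT i)
      (hind.precomp Fin.val_injective) (fun i => hlaw i) hRm (ha0 n) han.le hRa (hSm n)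
      (fun u hu i j hij => hnear _ (deviationScale_pos ht hn) hεn u hu.1 hu.2 i j hij)
    -- The sampled angles always lie in [0, 2π), so the cube condition in `S n` is automatic.
    convert hmain using 5
    ext ω
    simp only [Set.mem_ofPred_eq, hS, hTmem, implies_true, true_and]
  have hdiff := squeeze_zero_norm' (hbound.mono fun n hn => by rwa [Real.norm_eq_abs]) herr
  have hexp := (Real.continuous_exp.tendsto _).comp hlam.neg
  have := hdiff.add hexp
  simpa using this

end Assembly

end UMax

end

theorem theorem6p2 (m : ℕ) [NeZero m] (hm : 2 ≤ m)
    -- the density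
    (p : ℝ → ℝ) (hp_cont : Continuous p) (hp_per : Function.Periodic p (2 * Real.pi))
    (hp_nonneg : ∀ x, 0 ≤ p x) (hp_int : ∫ x in (0 : ℝ)..(2 * Real.pi), p x = 1)
    (hp_pos : 0 < UMax.densityIntegral p m)
    -- the function g and its kernel
    (g : ℝ → ℝ) (hg_cont : ContinuousOn g (Set.Icc 0 (2 * Real.pi)))
    (hg_smooth : ∀ s ∈ Finset.Icc 1 (m - 1), ContDiffAt ℝ 3 g (2 * Real.pi * s / m))
    (hg_symm : ∀ x ∈ Set.Icc 0 (2 * Real.pi), g x = g (2 * Real.pi - x))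
    (hg_max : ∀ V : Fin m → Circle,
      IsMaxOn (UMax.kernel g) Set.univ V → UMax.IsRegularPolygon V)
    (hG : (UMax.matG g m).det ≠ 0)
    -- the random points
    {Ω : Type*} [MeasurableSpace Ω] (μ : Measure Ω) [IsProbabilityMeasure μ]
    (U : ℕ → Ω → Circle) (hU_meas : ∀ i, Measurable (U i)) (hU_indep : iIndepFun U μ)
    (hU_law : ∀ i, μ.map (U i) = UMax.circleLaw p)
    (t : ℝ) (ht : 0 < t) :
    Tendsto
      (fun n : ℕ => μ.real {ω |
        (n : ℝ) ^ (2 * (m : ℝ) / ((m : ℝ) - 1)) *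
          (1 / 2 * ∑ s ∈ Finset.Icc 1 (m - 1), (m : ℝ) * g (2 * Real.pi * s / m)
            - UMax.uMax (m := m) (UMax.kernel g) (fun i => U i ω) n) ≤ t})
      atTop
      (𝓝 (1 - Real.exp (-(t ^ (((m : ℝ) - 1) / 2) * UMax.constK g p m / m)))) := by
  obtain ⟨k, rfl⟩ : ∃ k, m = k + 1 := ⟨m - 1, by omega⟩
  have hk : 0 < k := by omega
  have h0 : g 0 = g (2 * Real.pi) := by
    simpa using hg_symm 0 ⟨le_rfl, Real.two_pi_pos.le⟩
  have heven := UMax.periodicExt_neg hg_symm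
  have hper := UMax.periodicExt_periodic g
  have hc := UMax.continuous_periodicExt hg_cont h0
  have hmax := UMax.onlyRegularMax_periodicExt hg_symm hg_max
  have hA : UMax.LocalExpansion k (UMax.periodicExt g) (-UMax.matG g (k + 1)) :=
    UMax.localExpansion_periodicExt hg_cont hg_symm hg_smooth hmax hG
  set T : ℕ → Ω → ℝ := fun i ω => UMax.polarAngle (U i ω) with hT
  have hTm : ∀ i, Measurable (T i) := fun i => UMax.measurable_polarAngle.comp (hU_meas i)
  have hTind : iIndepFun T μ :=
    hU_indep.comp (fun _ => UMax.polarAngle) fun _ => UMax.measurable_polarAngle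
  have hTlaw : ∀ i, μ.map (T i) = UMax.angleLaw p := by
    intro i
    rw [← UMax.map_polarAngle_circleLaw, ← hU_law i,
      Measure.map_map UMax.measurable_polarAngle (hU_meas i)]
    rfl
  have hTmem : ∀ i ω, T i ω ∈ Set.Ico 0 (2 * Real.pi) := fun i ω => UMax.polarAngle_mem _
  have main := UMax.tendsto_prob_no_tuple hk hp_cont hp_nonneg hp_per hc heven hper hmax hA
    hTm hTind hTlaw hTmem ht
  have hconst : (2 * Real.pi) ^ ((k : ℝ) / 2) * UMax.densityIntegral p (k + 1)
      / (Real.sqrt (-UMax.matG g (k + 1)).det * Real.Gamma ((k : ℝ) / 2 + 1))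
      = UMax.constK g p (k + 1) := by
    rw [UMax.constK]
    congr 3
    · congr 1
      push_cast
      ring
    · push_cast
      ring
  have hexpo : (((k + 1 : ℕ) : ℝ) - 1) / 2 = (k : ℝ) / 2 := by
    push_cast
    ring
  rw [hconst] at main
  rw [hexpo]
  refine (main.const_sub 1).congr' ?_
  filter_upwards [eventually_ge_atTop (k + 1)] with n hn
  have hn0 : 0 < n := by omega
  have hn' : (0 : ℝ) < n := by exact_mod_cast hn0
  -- From n ≥ m on the supremum in `uMax` runs over a nonempty finite set and is attained.
  have hne : Nonempty (Fin (k + 1) ↪o Fin n) := ⟨Fin.castLEOrderEmb hn⟩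
  have hms : MeasurableSet {ω | ∀ α : Fin (k + 1) ↪o Fin n,
      ¬ UMax.pairSum (UMax.periodicExt g) (UMax.regularAngles (k + 1))
        - UMax.deviationScale t k n ^ 2
          ≤ UMax.pairSum (UMax.periodicExt g) fun i => T (α i) ω} := by
    have e : {ω | ∀ α : Fin (k + 1) ↪o Fin n,
      ¬ UMax.pairSum (UMax.periodicExt g) (UMax.regularAngles (k + 1))
        - UMax.deviationScale t k n ^ 2
          ≤ UMax.pairSum (UMax.periodicExt g) fun i => T (α i) ω}
        = ⋂ α : Fin (k + 1) ↪o Fin n, {ω | UMax.pairSum (UMax.periodicExt g)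
          (UMax.regularAngles (k + 1)) - UMax.deviationScale t k n ^ 2
          ≤ UMax.pairSum (UMax.periodicExt g) fun i => T (α i) ω}ᶜ := by
      ext ω
      simp
    rw [e]
    refine MeasurableSet.iInter fun α => (measurableSet_le measurable_const ?_).compl
    exact (UMax.continuous_pairSum hc).measurable.comp
      (measurable_pi_lambda _ fun i => hTm (α i))
  rw [← probReal_compl_eq_one_sub hms]
  congr 1
  ext ω
  have hker : ∀ α : Fin (k + 1) ↪o Fin n, UMax.kernel g (fun i => U (α i) ω)
      = UMax.pairSum (UMax.periodicExt g) fun i => T (α i) ω := by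
    intro α
    rw [← UMax.kernel_exp hg_symm]
    congr 1
    ext i
    simp only [hT, UMax.exp_polarAngle]
  have hM := UMax.pairSum_regularAngles (Nat.succ_pos k) hg_symm
  have hE : 2 * ((k + 1 : ℕ) : ℝ) / (((k + 1 : ℕ) : ℝ) - 1) = 2 * ((k : ℝ) + 1) / k := by
    push_cast
    ring
  have hpos : (0 : ℝ) < (n : ℝ) ^ (2 * ((k : ℝ) + 1) / k) := by positivity
  simp only [Set.mem_compl_iff, Set.mem_ofPred_eq, not_forall, not_not]
  -- Dividing by the power of n, the event becomes M - r² ≤ H_n, which holds exactly when some tuple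
  -- reaches M - r².
  rw [← hM, hE, UMax.deviationScale_sq ht, ← le_div_iff₀' hpos, sub_le_comm, div_eq_mul_inv,
    UMax.uMax]
  simp only [hker]
  constructor
  · rintro ⟨α, hα⟩
    exact hα.trans (le_ciSup (f := fun α : Fin (k + 1) ↪o Fin n =>
      UMax.pairSum (UMax.periodicExt g) fun i => T (α i) ω) (Set.finite_range _).bddAbove α)
  · intro hle
    obtain ⟨α, hα⟩ := exists_eq_ciSup_of_finite (f := fun α : Fin (k + 1) ↪o Fin n =>
      UMax.pairSum (UMax.periodicExt g) fun i => T (α i) ω)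
    exact ⟨α, hle.trans_eq hα.symm⟩
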